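/- Let $d\ge 2$ be an integer and $\mathbb{R}^d_+=\{x\in\mathbb{R}^d: x_d>0\}$. Let $0<s<1$, $p\ge 2$, $sp<d$, let $\alpha,\beta\in\mathbb{R}$ satisfy $\alpha,\beta,\alpha+\beta\in(-1,sp)$ and $1+\alpha+\beta\ne sp$, and put $q=\frac{dp}{d-sp}$ and $$\mathcal{D}=\mathcal{D}(d,s,p,\alpha,\beta)=\frac{\pi^{\frac{d-1}{2}}\,\Gamma\left(\frac{1+sp}{2}\right)}{\Gamma\left(\frac{d+sp}{2}\right)}\int_0^1\frac{(t^\alpha+t^\beta)\left|1-t^{-\frac{1+\alpha+\beta-sp}{p}}\right|^p}{(1-t)^{1+sp}}\,dt .$$ Then there is a constant $C=C(\alpha,\beta,d,s,p)>0$ such that for every continuous function $u:\mathbb{R}^d_+\to\mathbb{R}$ with compact support in $\mathbb{R}^d_+$ the quantity $\mathcal{D}\int_{\mathbb{R}^d_+}|u(x)|^p\,x_d^{\alpha+\beta-sp}\,dx$ is finite and $$\int_{\mathbb{R}^d_+}\int_{\mathbb{R}^d_+}\frac{|u(x)-u(y)|^p}{|x-y|^{d+sp}}\,x_d^{\alpha}\,y_d^{\beta}\,dy\,dx-\mathcal{D}\int_{\mathbb{R}^d_+}\frac{|u(x)|^p}{x_d^{sp-\alpha-\beta}}\,dx\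 \ge\ C\left(\int_{\mathbb{R}^d_+}|u(x)|^q\,x_d^{\frac{q}{p}(\alpha+\beta)}\,dx\right)^{\frac pq},$$ where the double integral may be $+\infty$. -/

import Mathlib

open MeasureTheory
open scoped ENNReal NNReal

/-- The half-space `ℝ^{n+1}_+`: the points of `ℝ^{n+1}` with positive last coordinate. -/
def halfSpace (n : ℕ) : Set (EuclideanSpace ℝ (Fin (n + 1))) :=
  {x | 0 < x (Fin.last n)}

/-- The space `C_c(ℝ^{n+1}_+)`, each function being extended by zero to `ℝ^{n+1}`: continuous
functions whose (closed) support is compact and contained in the open half-space. -/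
def CcHalfSpace (n : ℕ) : Set (EuclideanSpace ℝ (Fin (n + 1)) → ℝ) :=
  {u | Continuous u ∧ HasCompactSupport u ∧ tsupport u ⊆ halfSpace n}

/-- The constant `𝒟(d, s, p, α, β)`, as the value in `[0, ∞]` of an integral of a nonnegative
function. -/
noncomputable def hardyConst (d : ℕ) (s p α β : ℝ) : ℝ≥0∞ :=
  ENNReal.ofReal (Real.pi ^ (((d : ℝ) - 1) / 2) * Real.Gamma ((1 + s * p) / 2) /
      Real.Gamma (((d : ℝ) + s * p) / 2)) *
    ∫⁻ t in Set.Ioo (0 : ℝ) 1,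
      ENNReal.ofReal ((t ^ α + t ^ β) * |1 - t ^ (-((1 + α + β - s * p) / p))| ^ p /
        (1 - t) ^ (1 + s * p))

/-- The weighted Gagliardo energy
`∫_{ℝ^d_+} ∫_{ℝ^d_+} |u(x) - u(y)|^p / |x - y|^{d + sp} x_d^α y_d^β dy dx`, `d = n + 1`,
with value in `[0, ∞]`. -/
noncomputable def weightedEnergy (n : ℕ) (s p α β : ℝ)
    (u : EuclideanSpace ℝ (Fin (n + 1)) → ℝ) : ℝ≥0∞ :=
  ∫⁻ x in halfSpace n, ∫⁻ y in halfSpace n,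
    ENNReal.ofReal (|u x - u y| ^ p / ‖x - y‖ ^ (((n + 1 : ℕ) : ℝ) + s * p) *
      x (Fin.last n) ^ α * y (Fin.last n) ^ β)

/-- The Hardy term `∫_{ℝ^d_+} |u(x)|^p / x_d^{sp - α - β} dx`, `d = n + 1`. -/
noncomputable def hardyTerm (n : ℕ) (s p α β : ℝ)
    (u : EuclideanSpace ℝ (Fin (n + 1)) → ℝ) : ℝ≥0∞ :=
  ∫⁻ x in halfSpace n,
    ENNReal.ofReal (|u x| ^ p / x (Fin.last n) ^ (s * p - α - β))

/-- The weighted Sobolev integral `∫_{ℝ^d_+} |u(x)|^q x_d^{(q/p)(α + β)} dx`, `d = n + 1`. -/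
noncomputable def sobolevIntegral (n : ℕ) (p q α β : ℝ)
    (u : EuclideanSpace ℝ (Fin (n + 1)) → ℝ) : ℝ≥0∞ :=
  ∫⁻ x in halfSpace n,
    ENNReal.ofReal (|u x| ^ q * x (Fin.last n) ^ (q / p * (α + β)))

/-! Write `σ = s * p`, `d = n + 1`, `γ = (1 + α + β - σ) / p` and `u = v * x_d ^ (-γ)`. The proof is
a ground state representation with remainder, followed by a Sobolev inequality for the remainder.

The power `x_d ^ (-γ)` is the virtual ground state of the Hardy inequality. For `p ≥ 2`,
quantitative convexity of `|·| ^ p` gives `groundState_pointwise`, which bounds `|u x - u y| ^ p`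
from below by a term in `|u x| ^ p`, a term in `|u y| ^ p`, and a multiple of `|v x - v y| ^ p`.
Against the symmetrized kernel on pairs with `y_d < x_d`, each of the first two terms integrates to
the Hardy term times a one-dimensional integral in the ratio `t = y_d / x_d`. The exponent `γ` is
the one for which these integrals differ exactly by the integral in `𝒟` (`dual_weight_identity`).
Each of them may diverge at `t = 1`, so the identity is used for `t < τ < 1` and `τ` tends to `1` by
monotone convergence (`groundState_truncated`, `hardy_add_balancedEnergy_le`). By AM-GM on the
kernel, the remainder dominates an energy of `v` with weight `(x_d y_d) ^ ((σ - 1) / 2)`, from which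
`α` and `β` have disappeared.

It remains to prove a weighted Sobolev inequality for this energy `E`
(`exists_sobolev_balancedEnergy`). The value `v x` is telescoped over averages of `v` on balls lying
above `x` at dyadic distances `ρ`. Jensen bounds a step by the energy `e` between two consecutive
balls. Each `e` is at most `E`, while a weighted sum `G x` of them over the scales has integral at
most a constant times `E`. Playing the two bounds against each other, as in Hedberg's argument,
gives `x_d ^ ((σ - 1) / p) * |v x| ≤ C * (E ^ (1 - θ) * G x ^ θ) ^ (1 / p)` with `θ = p / q`. Its
`q`-th power is linear in `G` and can be integrated. Scales below `x_d` and above `x_d` need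
different weights in `G`, hence the separate lemmas for small and large steps. -/

/-! ### Quantitative convexity of `|·| ^ p` -/

/-- Clarkson's inequality: on squares, the power `p / 2 ≥ 1` is superadditive and convex, and the
parallelogram law links the two. -/
theorem abs_rpow_midpoint_add_le {p : ℝ} (hp : 2 ≤ p) (X Y : ℝ) :
    |(X + Y) / 2| ^ p + |(X - Y) / 2| ^ p ≤ (|X| ^ p + |Y| ^ p) / 2 := by
  have key : ∀ z : ℝ, |z| ^ p = (z ^ 2) ^ (p / 2) := by
    intro z
    rw [← sq_abs, ← Real.rpow_natCast, ← Real.rpow_mul (abs_nonneg z)]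
    congr 1; push_cast; ring
  simp only [key]
  have h1 := Real.add_rpow_le_rpow_add (sq_nonneg ((X + Y) / 2)) (sq_nonneg ((X - Y) / 2))
    (show 1 ≤ p / 2 by linarith)
  have h2 := (convexOn_rpow (show 1 ≤ p / 2 by linarith)).2 (x := X ^ 2) (y := Y ^ 2)
    (Set.mem_Ici.2 (sq_nonneg _)) (Set.mem_Ici.2 (sq_nonneg _))
    (show (0 : ℝ) ≤ 1 / 2 by norm_num) (show (0 : ℝ) ≤ 1 / 2 by norm_num) (by norm_num)
  simp only [smul_eq_mul] at h2
  have h3 : ((X + Y) / 2) ^ 2 + ((X - Y) / 2) ^ 2 = 1 / 2 * X ^ 2 + 1 / 2 * Y ^ 2 := by ring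
  rw [h3] at h1
  linarith

theorem abs_rpow_tangent_le {p : ℝ} (hp : 2 ≤ p) (a m : ℝ) :
    |a| ^ p + p * |a| ^ (p - 2) * a * (m - a) ≤ |m| ^ p := by
  have hp0 : 0 < p := by linarith
  rcases eq_or_ne a 0 with rfl | ha
  · simp [Real.zero_rpow hp0.ne']; positivity
  have ha' : 0 < |a| := abs_pos.2 ha
  have h1 := Real.geom_mean_le_arith_mean2_weighted (w₁ := (p - 1) / p) (w₂ := 1 / p)
    (p₁ := |a| ^ p) (p₂ := |m| ^ p) (div_nonneg (by linarith) hp0.le) (by positivity)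
    (by positivity) (by positivity) (by field_simp; ring)
  rw [← Real.rpow_mul ha'.le, ← Real.rpow_mul (abs_nonneg m), mul_div_cancel₀ _ hp0.ne',
    mul_div_cancel₀ _ hp0.ne', Real.rpow_one] at h1
  have h2 : |a| ^ (p - 1) = |a| ^ (p - 2) * |a| := by
    rw [← Real.rpow_add_one ha'.ne']; congr 1; ring
  have h3 : |a| ^ p = |a| ^ (p - 2) * (a * a) := by
    rw [← abs_mul_abs_self a, ← mul_assoc, ← Real.rpow_add_one ha'.ne',
      ← Real.rpow_add_one ha'.ne']; congr 1; ring
  have h4 : a * m ≤ |a| * |m| := by rw [← abs_mul]; exact le_abs_self _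
  have h5 : |a| ^ (p - 2) * (a * m) ≤ |a| ^ (p - 2) * (|a| * |m|) := by gcongr
  have h6 : p * (|a| ^ (p - 1) * |m|) ≤ (p - 1) * |a| ^ p + |m| ^ p := by
    calc p * (|a| ^ (p - 1) * |m|) ≤ p * ((p - 1) / p * |a| ^ p + 1 / p * |m| ^ p) := by gcongr
      _ = _ := by field_simp
  rw [h2] at h6
  nlinarith

/-- The plain tangent bound is applied at the midpoint of `a` and `b`; Clarkson's inequality then
turns it into a bound at `b` with a gain. -/
theorem abs_rpow_tangent_add_le {p : ℝ} (hp : 2 ≤ p) (a b : ℝ) :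
    |a| ^ p + p * |a| ^ (p - 2) * a * (b - a) + 2 ^ (1 - p) * |b - a| ^ p ≤ |b| ^ p := by
  have h1 := abs_rpow_midpoint_add_le hp a b
  have h2 := abs_rpow_tangent_le hp a ((a + b) / 2)
  have h3 : |(a - b) / 2| ^ p = 2 ^ (1 - p) * |b - a| ^ p / 2 := by
    rw [abs_div, abs_sub_comm, Real.div_rpow (abs_nonneg _) (abs_nonneg _),
      Real.rpow_sub (by norm_num : (0 : ℝ) < 2), Real.rpow_one, abs_of_pos (by norm_num : (0:ℝ) < 2)]
    field_simp
  rw [h3] at h1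
  nlinarith

/-- Average the tangent bounds from the barycentre to its two endpoints: the linear terms cancel and
the gains remain. -/
theorem abs_rpow_strong_convexity {p : ℝ} (hp : 2 ≤ p) {l X Y : ℝ} (hl0 : 0 ≤ l) (hl1 : l ≤ 1) :
    |(1 - l) * X + l * Y| ^ p +
        2 ^ (1 - p) * ((1 - l) * |l * (X - Y)| ^ p + l * |(1 - l) * (X - Y)| ^ p) ≤
      (1 - l) * |X| ^ p + l * |Y| ^ p := by
  set M := (1 - l) * X + l * Y with hM
  have hX := mul_le_mul_of_nonneg_left (abs_rpow_tangent_add_le hp M X) (sub_nonneg.2 hl1)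
  have hY := mul_le_mul_of_nonneg_left (abs_rpow_tangent_add_le hp M Y) hl0
  have eX : X - M = l * (X - Y) := by rw [hM]; ring
  have eY : |Y - M| = |(1 - l) * (X - Y)| := by
    rw [← abs_neg]; congr 1; rw [hM]; ring
  rw [eY] at hY
  rw [eX] at hX
  have eY' : Y - M = -((1 - l) * (X - Y)) := by rw [hM]; ring
  rw [eY'] at hY
  nlinarith

/-- The pointwise inequality behind the ground state representation with remainder. -/
theorem groundState_pointwise {p : ℝ} (hp : 2 ≤ p) {w W : ℝ} (hw : 0 < w) (hwW : w ≤ W)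
    (a b : ℝ) :
    (W - w) ^ (p - 1) * W * |a| ^ p + (2 ^ (1 - p)) ^ 2 * (W * w) ^ (p / 2) * |a - b| ^ p ≤
      |W * a - w * b| ^ p + (W - w) ^ (p - 1) * w * |b| ^ p := by
  have hW : 0 < W := hw.trans_le hwW
  have hp0 : 0 < p := by linarith
  have h2p : (2 : ℝ) ^ (1 - p) ≤ 1 :=
    Real.rpow_le_one_of_one_le_of_nonpos (by norm_num) (by linarith)
  have h2p0 : (0 : ℝ) < 2 ^ (1 - p) := by positivity
  -- For `W = w` the point `X` below is undefined, but the terms with `(W - w) ^ (p - 1)` vanish.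
  rcases hwW.eq_or_lt with rfl | hlt
  · rw [sub_self, Real.zero_rpow (by linarith), ← mul_sub, abs_mul, abs_of_pos hw,
      Real.mul_rpow hw.le (abs_nonneg _)]
    have e : (w * w) ^ (p / 2) = w ^ p := by
      rw [← sq, ← Real.rpow_natCast, ← Real.rpow_mul hw.le]; congr 1; push_cast; ring
    rw [e]
    have h1 : ((2 : ℝ) ^ (1 - p)) ^ 2 ≤ 1 := pow_le_one₀ h2p0.le h2p
    have h2 : 0 ≤ w ^ p * |a - b| ^ p := by positivity
    nlinarith
  have hd : 0 < W - w := sub_pos.2 hlt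
  -- These choices make `a = (1 - l) * X + l * b`, so strong convexity, multiplied by `W * (W - w) ^
  -- (p - 1)`, is the claim up to the shape of the gain.
  set l := w / W with hl
  set X := (W * a - w * b) / (W - w) with hX
  have hl1 : 1 - l = (W - w) / W := by rw [hl]; field_simp
  have key := abs_rpow_strong_convexity hp (l := l) (X := X) (Y := b) (by positivity)
    (by rw [hl, div_le_one hW]; exact hwW)
  have e1 : (1 - l) * X + l * b = a := by rw [hl1, hX, hl]; field_simp; ring
  have e2 : |l * (X - b)| = w / (W - w) * |a - b| := by
    rw [← abs_of_pos (div_pos hw hd), ← abs_mul]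
    congr 1; rw [hl, hX]; field_simp; ring
  have e3 : |(1 - l) * (X - b)| = |a - b| := by
    congr 1; rw [hl1, hX]; field_simp; ring
  have e4 : |X| ^ p = |W * a - w * b| ^ p / ((W - w) ^ (p - 1) * (W - w)) := by
    rw [hX, abs_div, abs_of_pos hd, Real.div_rpow (abs_nonneg _) hd.le,
      ← Real.rpow_add_one hd.ne', sub_add_cancel]
  have e5 : (w / (W - w) * |a - b|) ^ p = w ^ (p - 1) * w / ((W - w) ^ (p - 1) * (W - w))
      * |a - b| ^ p := by
    rw [Real.mul_rpow (by positivity) (abs_nonneg _),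
      Real.div_rpow hw.le hd.le, ← Real.rpow_add_one hd.ne', ← Real.rpow_add_one hw.ne',
      sub_add_cancel]
  rw [e1, e2, e3, e4, e5, hl1, hl] at key
  set D := (W - w) ^ (p - 1) with hD
  have hD0 : 0 < D := by positivity
  have key2 := mul_le_mul_of_nonneg_left key (show 0 ≤ W * D by positivity)
  have key3 : W * D * |a| ^ p + 2 ^ (1 - p) * (w * (w ^ (p - 1) + D) * |a - b| ^ p) ≤
      |W * a - w * b| ^ p + D * w * |b| ^ p := by
    refine le_trans (le_of_eq ?_) (key2.trans (le_of_eq ?_))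
    · field_simp
    · field_simp
  -- One of `w` and `W - w` is at least `W / 2`; this costs the second factor `2 ^ (1 - p)`.
  have hhalf : 2 ^ (1 - p) * W ^ (p - 1) ≤ w ^ (p - 1) + D := by
    have e : (2 : ℝ) ^ (1 - p) * W ^ (p - 1) = (W / 2) ^ (p - 1) := by
      rw [Real.div_rpow hW.le (by norm_num), show (1 - p) = -(p - 1) by ring,
        Real.rpow_neg (by norm_num)]; field_simp
    rw [e]
    rcases le_total (W / 2) w with h | h
    · have := Real.rpow_le_rpow (by positivity) h (show 0 ≤ p - 1 by linarith)
      linarith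
    · have := Real.rpow_le_rpow (by positivity) (show W / 2 ≤ W - w by linarith)
        (show 0 ≤ p - 1 by linarith)
      have : 0 ≤ w ^ (p - 1) := by positivity
      linarith
  have hgm : (W * w) ^ (p / 2) ≤ w * W ^ (p - 1) := by
    have a1 : w ^ (p / 2) = w * w ^ (p / 2 - 1) := by
      rw [mul_comm, ← Real.rpow_add_one hw.ne', sub_add_cancel]
    have a2 : W ^ (p - 1) = W ^ (p / 2 - 1) * W ^ (p / 2) := by
      rw [← Real.rpow_add hW]; congr 1; ring
    have a3 : w ^ (p / 2 - 1) ≤ W ^ (p / 2 - 1) :=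
      Real.rpow_le_rpow hw.le hwW (by linarith)
    rw [Real.mul_rpow hW.le hw.le, a1, a2]
    calc W ^ (p / 2) * (w * w ^ (p / 2 - 1)) ≤ W ^ (p / 2) * (w * W ^ (p / 2 - 1)) := by gcongr
      _ = _ := by ring
  have hfin : (2 ^ (1 - p)) ^ 2 * (W * w) ^ (p / 2) * |a - b| ^ p ≤
      2 ^ (1 - p) * (w * (w ^ (p - 1) + D) * |a - b| ^ p) := by
    calc (2 ^ (1 - p)) ^ 2 * (W * w) ^ (p / 2) * |a - b| ^ p
        ≤ (2 ^ (1 - p)) ^ 2 * (w * W ^ (p - 1)) * |a - b| ^ p := by gcongr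
      _ = 2 ^ (1 - p) * (w * (2 ^ (1 - p) * W ^ (p - 1)) * |a - b| ^ p) := by ring
      _ ≤ _ := by gcongr
  linarith

/-! ### Dyadic sums with decay on both sides -/

/-- The bounded increasing function `x ^ m / (1 + x ^ m)`, `m = min s t`, grows under doubling by an
amount comparable to `min (x ^ m) (x ^ (-m))`. -/
theorem min_rpow_le_telescope {s t : ℝ} {x : ℝ} (hx : 0 < x) (hs : 0 < s) (ht : 0 < t) :
    min (x ^ s) (x ^ (-t)) * ((2 ^ min s t - 1) / (2 * (1 + 2 ^ min s t))) ≤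
      (2 * x) ^ min s t / (1 + (2 * x) ^ min s t) - x ^ min s t / (1 + x ^ min s t) := by
  set m := min s t with hm
  have hm0 : 0 < m := lt_min hs ht
  have hT : (1 : ℝ) < 2 ^ m := Real.one_lt_rpow (by norm_num) hm0
  set T := (2 : ℝ) ^ m with hTdef
  have hX : 0 < x ^ m := Real.rpow_pos_of_pos hx m
  rw [Real.mul_rpow (by norm_num) hx.le, ← hTdef]
  have e : T * x ^ m / (1 + T * x ^ m) - x ^ m / (1 + x ^ m) =
      x ^ m * (T - 1) / ((1 + x ^ m) * (1 + T * x ^ m)) := by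
    field_simp; ring
  rw [e]
  rcases le_total x 1 with h | h
  · have h1 : min (x ^ s) (x ^ (-t)) ≤ x ^ m :=
      (min_le_left _ _).trans (Real.rpow_le_rpow_of_exponent_ge hx h (min_le_left _ _))
    have hX1 : x ^ m ≤ 1 := Real.rpow_le_one hx.le h hm0.le
    calc min (x ^ s) (x ^ (-t)) * ((T - 1) / (2 * (1 + T)))
        ≤ x ^ m * ((T - 1) / (2 * (1 + T))) := by
          have : 0 ≤ (T - 1) / (2 * (1 + T)) := div_nonneg (by linarith) (by linarith)
          gcongr
      _ = x ^ m * (T - 1) / (2 * (1 + T)) := by ring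
      _ ≤ _ := by
          have : 0 ≤ x ^ m * (T - 1) := mul_nonneg hX.le (by linarith)
          apply div_le_div_of_nonneg_left this (by positivity)
          apply mul_le_mul <;> nlinarith
  · have h1 : min (x ^ s) (x ^ (-t)) ≤ (x ^ m)⁻¹ := by
      rw [← Real.rpow_neg hx.le]
      exact (min_le_right _ _).trans
        (Real.rpow_le_rpow_of_exponent_le h (neg_le_neg (min_le_right _ _)))
    have hX1 : 1 ≤ x ^ m := Real.one_le_rpow h hm0.le
    calc min (x ^ s) (x ^ (-t)) * ((T - 1) / (2 * (1 + T)))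
        ≤ (x ^ m)⁻¹ * ((T - 1) / (2 * (1 + T))) := by
          have : 0 ≤ (T - 1) / (2 * (1 + T)) := div_nonneg (by linarith) (by linarith)
          gcongr
      _ = x ^ m * (T - 1) / ((2 * x ^ m) * ((1 + T) * x ^ m)) := by field_simp
      _ ≤ _ := by
          have : 0 ≤ x ^ m * (T - 1) := mul_nonneg hX.le (by linarith)
          apply div_le_div_of_nonneg_left this (by positivity)
          apply mul_le_mul <;> nlinarith

/-- The sum telescopes into a difference of two values in `[0, 1]`, so the bound does not depend on
the starting scale `X`. -/
theorem exists_sum_min_rpow_le {s t : ℝ} (hs : 0 < s) (ht : 0 < t) :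
    ∃ C : ℝ, 0 < C ∧ ∀ X : ℝ, 0 < X → ∀ J : ℕ,
      ∑ j ∈ Finset.range J, min ((X * (1 / 2) ^ j) ^ s) ((X * (1 / 2) ^ j) ^ (-t)) ≤ C := by
  have hT : (1 : ℝ) < 2 ^ min s t := Real.one_lt_rpow (by norm_num) (lt_min hs ht)
  set T := (2 : ℝ) ^ min s t with hTdef
  have hc : 0 < (T - 1) / (2 * (1 + T)) := div_pos (by linarith) (by linarith)
  refine ⟨((T - 1) / (2 * (1 + T)))⁻¹, inv_pos.2 hc, fun X hX J => ?_⟩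
  rw [← one_div, le_div_iff₀ hc, Finset.sum_mul]
  set f : ℕ → ℝ := fun j => (2 * (X * (1 / 2) ^ j)) ^ min s t /
    (1 + (2 * (X * (1 / 2) ^ j)) ^ min s t) with hf
  have h1 : ∀ j ∈ Finset.range J, min ((X * (1 / 2) ^ j) ^ s) ((X * (1 / 2) ^ j) ^ (-t)) *
      ((T - 1) / (2 * (1 + T))) ≤ f j - f (j + 1) := by
    intro j _
    have := min_rpow_le_telescope (x := X * (1 / 2) ^ j) (by positivity) hs ht
    have e : f (j + 1) = (X * (1 / 2) ^ j) ^ min s t / (1 + (X * (1 / 2) ^ j) ^ min s t) := by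
      have : 2 * (X * (1 / 2) ^ (j + 1)) = X * (1 / 2) ^ j := by rw [pow_succ]; ring
      simp only [hf, this]
    rw [e]; exact this
  refine (Finset.sum_le_sum h1).trans ?_
  rw [Finset.sum_range_sub']
  have h2 : f 0 ≤ 1 := by
    simp only [hf]
    rw [div_le_one (by positivity)]
    linarith
  have h3 : 0 ≤ f J := by simp only [hf]; positivity
  linarith

/-! ### Finiteness of the one-dimensional integrals -/

theorem setLIntegral_rpow_lt_top {a : ℝ} (ha : -1 < a) :
    ∫⁻ t in Set.Ioo (0 : ℝ) 1, ENNReal.ofReal (t ^ a) < ∞ := by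
  have h := intervalIntegral.intervalIntegrable_rpow' (a := 0) (b := 1) ha
  rw [intervalIntegrable_iff_integrableOn_Ioo_of_le zero_le_one] at h
  exact h.lintegral_lt_top

theorem setLIntegral_one_sub_rpow_lt_top {b : ℝ} (hb : -1 < b) :
    ∫⁻ t in Set.Ioo (0 : ℝ) 1, ENNReal.ofReal ((1 - t) ^ b) < ∞ := by
  have h := (intervalIntegral.intervalIntegrable_rpow' (a := 0) (b := 1) hb).comp_sub_left 1
  simp only [sub_zero, sub_self] at h
  have h := h.symm
  rw [intervalIntegrable_iff_integrableOn_Ioo_of_le zero_le_one] at h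
  exact h.lintegral_lt_top

theorem rpow_mul_one_sub_rpow_le {a b t : ℝ} (ht : t ∈ Set.Ioo (0 : ℝ) 1) :
    t ^ a * (1 - t) ^ b ≤ (2 ^ |a| + 2 ^ |b|) * (t ^ a + (1 - t) ^ b) := by
  have key : ∀ (x c : ℝ), 1 / 2 ≤ x → x ≤ 1 → x ^ c ≤ 2 ^ |c| := by
    intro x c h1 h2
    have hx : 0 < x := by linarith
    calc x ^ c ≤ x ^ (-|c|) := Real.rpow_le_rpow_of_exponent_ge hx h2 (neg_abs_le c)
      _ = (x⁻¹) ^ |c| := by rw [Real.rpow_neg hx.le, Real.inv_rpow hx.le]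
      _ ≤ 2 ^ |c| := by
        apply Real.rpow_le_rpow (by positivity) _ (abs_nonneg c)
        rw [inv_le_comm₀ hx (by norm_num)]; linarith
  have h1 : 0 < t ^ a := Real.rpow_pos_of_pos ht.1 _
  have h2 : 0 < (1 - t) ^ b := Real.rpow_pos_of_pos (sub_pos.2 ht.2) _
  have ha : (0 : ℝ) < 2 ^ |a| := by positivity
  have hb : (0 : ℝ) < 2 ^ |b| := by positivity
  rcases le_total t (1 / 2) with h | h
  · have := key (1 - t) b (by linarith) (by linarith [ht.1])
    nlinarith [mul_le_mul_of_nonneg_left this h1.le, mul_pos ha h1, mul_pos ha h2, mul_pos hb h2]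
  · have := key t a h ht.2.le
    nlinarith [mul_le_mul_of_nonneg_right this h2.le, mul_pos ha h1, mul_pos hb h1, mul_pos hb h2]

theorem setLIntegral_beta_lt_top {a b : ℝ} (ha : -1 < a) (hb : -1 < b) :
    ∫⁻ t in Set.Ioo (0 : ℝ) 1, ENNReal.ofReal (t ^ a * (1 - t) ^ b) < ∞ := by
  calc ∫⁻ t in Set.Ioo (0 : ℝ) 1, ENNReal.ofReal (t ^ a * (1 - t) ^ b)
      ≤ ∫⁻ t in Set.Ioo (0 : ℝ) 1, ENNReal.ofReal (2 ^ |a| + 2 ^ |b|) *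
          (ENNReal.ofReal (t ^ a) + ENNReal.ofReal ((1 - t) ^ b)) := by
        refine setLIntegral_mono' measurableSet_Ioo fun t ht => ?_
        rw [← ENNReal.ofReal_add (Real.rpow_nonneg ht.1.le _)
          (Real.rpow_nonneg (sub_nonneg.2 ht.2.le) _), ← ENNReal.ofReal_mul (by positivity)]
        exact ENNReal.ofReal_le_ofReal (rpow_mul_one_sub_rpow_le ht)
    _ = ENNReal.ofReal (2 ^ |a| + 2 ^ |b|) *
          ((∫⁻ t in Set.Ioo (0 : ℝ) 1, ENNReal.ofReal (t ^ a)) +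
          ∫⁻ t in Set.Ioo (0 : ℝ) 1, ENNReal.ofReal ((1 - t) ^ b)) := by
        rw [lintegral_const_mul _ (by fun_prop), lintegral_add_left (by fun_prop)]
    _ < ∞ := ENNReal.mul_lt_top ENNReal.ofReal_lt_top
        (ENNReal.add_lt_top.2 ⟨setLIntegral_rpow_lt_top ha, setLIntegral_one_sub_rpow_lt_top hb⟩)

theorem one_sub_rpow_le {g t : ℝ} (hg : 0 ≤ g) (ht0 : 0 < t) (ht1 : t < 1) :
    1 - t ^ g ≤ (1 + g) * (1 - t) := by
  rcases le_total g 1 with h | h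
  · have := Real.rpow_le_rpow_of_exponent_ge ht0 ht1.le h
    rw [Real.rpow_one] at this
    nlinarith
  · have := one_add_mul_self_le_rpow_one_add (s := t - 1) (by linarith) h
    rw [show 1 + (t - 1) = t by ring] at this
    nlinarith

theorem abs_one_sub_rpow_le {γ t : ℝ} (ht0 : 0 < t) (ht1 : t < 1) :
    |1 - t ^ (-γ)| ≤ (1 + |γ|) * (1 - t) * max 1 (t ^ (-γ)) := by
  have h1 : 0 < 1 - t := sub_pos.2 ht1
  rcases le_total γ 0 with h | h
  · have h2 := one_sub_rpow_le (g := -γ) (by linarith) ht0 ht1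
    have h3 : t ^ (-γ) ≤ 1 := Real.rpow_le_one ht0.le ht1.le (by linarith)
    rw [abs_of_nonneg (by linarith), abs_of_nonpos h, max_eq_left h3]
    linarith
  · have h2 := one_sub_rpow_le h ht0 ht1
    have h3 : 1 ≤ t ^ (-γ) := Real.one_le_rpow_of_pos_of_le_one_of_nonpos ht0 ht1.le (by linarith)
    rw [abs_of_nonpos (by linarith), abs_of_nonneg h, max_eq_right h3]
    have h4 : t ^ (-γ) * t ^ γ = 1 := by rw [← Real.rpow_add ht0]; simp
    nlinarith

/-- At `t = 1` the numerator vanishes to order `p > σ`. At `t = 0` the exponents that occur are `α`,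
`β` and, after multiplication by `t ^ (-γ * p)`, `σ - 1 - β` and `σ - 1 - α`; all exceed `-1`. -/
theorem hardyIntegral_lt_top {α β σ p γ : ℝ} (hp : 0 < p) (hσp : σ < p) (hα : α ∈ Set.Ioo (-1) σ)
    (hβ : β ∈ Set.Ioo (-1) σ) (hγ : γ = (1 + α + β - σ) / p) :
    ∫⁻ t in Set.Ioo (0 : ℝ) 1,
      ENNReal.ofReal ((t ^ α + t ^ β) * |1 - t ^ (-γ)| ^ p / (1 - t) ^ (1 + σ)) < ∞ := by
  have hb : -1 < p - (1 + σ) := by linarith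
  have fin : ∀ a : ℝ, -1 < a →
      ∫⁻ t in Set.Ioo (0 : ℝ) 1, ENNReal.ofReal (t ^ a * (1 - t) ^ (p - (1 + σ))) < ∞ :=
    fun a ha => setLIntegral_beta_lt_top ha hb
  calc ∫⁻ t in Set.Ioo (0 : ℝ) 1,
      ENNReal.ofReal ((t ^ α + t ^ β) * |1 - t ^ (-γ)| ^ p / (1 - t) ^ (1 + σ))
      ≤ ∫⁻ t in Set.Ioo (0 : ℝ) 1, ENNReal.ofReal ((1 + |γ|) ^ p) *
        (ENNReal.ofReal (t ^ α * (1 - t) ^ (p - (1 + σ))) +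
         ENNReal.ofReal (t ^ β * (1 - t) ^ (p - (1 + σ))) +
         ENNReal.ofReal (t ^ (σ - 1 - β) * (1 - t) ^ (p - (1 + σ))) +
         ENNReal.ofReal (t ^ (σ - 1 - α) * (1 - t) ^ (p - (1 + σ)))) := by
        refine setLIntegral_mono' measurableSet_Ioo fun t ht => ?_
        have h1 : 0 < 1 - t := sub_pos.2 ht.2
        have h0 : 0 < t := ht.1
        rw [← ENNReal.ofReal_add (by positivity) (by positivity),
          ← ENNReal.ofReal_add (by positivity) (by positivity),
          ← ENNReal.ofReal_add (by positivity) (by positivity), ← ENNReal.ofReal_mul (by positivity)]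
        apply ENNReal.ofReal_le_ofReal
        have e1 : |1 - t ^ (-γ)| ^ p ≤ (1 + |γ|) ^ p * (1 - t) ^ p * (1 + t ^ (-γ * p)) := by
          refine (Real.rpow_le_rpow (abs_nonneg _) (abs_one_sub_rpow_le h0 ht.2) hp.le).trans ?_
          rw [Real.mul_rpow (by positivity) (by positivity),
            Real.mul_rpow (by positivity) (by positivity)]
          gcongr
          rw [Real.rpow_mul h0.le]
          have hz : 0 < (t ^ (-γ)) ^ p := by positivity
          rcases max_choice 1 (t ^ (-γ)) with h | h <;> rw [h]
          · rw [Real.one_rpow]; linarith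
          · linarith
        have e2 : t ^ α * t ^ (-γ * p) = t ^ (σ - 1 - β) := by
          rw [← Real.rpow_add h0]; congr 1; rw [hγ]; field_simp; ring
        have e3 : t ^ β * t ^ (-γ * p) = t ^ (σ - 1 - α) := by
          rw [← Real.rpow_add h0]; congr 1; rw [hγ]; field_simp; ring
        rw [← e2, ← e3, Real.rpow_sub h1]
        calc (t ^ α + t ^ β) * |1 - t ^ (-γ)| ^ p / (1 - t) ^ (1 + σ)
            ≤ (t ^ α + t ^ β) * ((1 + |γ|) ^ p * (1 - t) ^ p * (1 + t ^ (-γ * p))) /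
              (1 - t) ^ (1 + σ) := by gcongr
          _ = _ := by ring
    _ = ENNReal.ofReal ((1 + |γ|) ^ p) *
        ((∫⁻ t in Set.Ioo (0 : ℝ) 1, ENNReal.ofReal (t ^ α * (1 - t) ^ (p - (1 + σ)))) +
         (∫⁻ t in Set.Ioo (0 : ℝ) 1, ENNReal.ofReal (t ^ β * (1 - t) ^ (p - (1 + σ)))) +
         (∫⁻ t in Set.Ioo (0 : ℝ) 1, ENNReal.ofReal (t ^ (σ - 1 - β) * (1 - t) ^ (p - (1 + σ)))) +
         (∫⁻ t in Set.Ioo (0 : ℝ) 1, ENNReal.ofReal (t ^ (σ - 1 - α) * (1 - t) ^ (p - (1 + σ))))) := by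
        rw [lintegral_const_mul _ (by fun_prop), lintegral_add_left (by fun_prop),
          lintegral_add_left (by fun_prop), lintegral_add_left (by fun_prop)]
    _ < ∞ := by
        refine ENNReal.mul_lt_top ENNReal.ofReal_lt_top ?_
        simp only [ENNReal.add_lt_top]
        exact ⟨⟨⟨fin α hα.1, fin β hβ.1⟩, fin _ (by linarith [hβ.2])⟩, fin _ (by linarith [hα.2])⟩

/-- This is the quantity cancelled in the ground state argument. The minimum treats both signs of
`γ` together, and `τ < 1` keeps the singular factor at `t = 1` bounded. -/
theorem truncated_integral_lt_top {α β σ p γ τ : ℝ} (hp : 1 ≤ p) (hσ : 0 < σ)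
    (hα : α ∈ Set.Ioo (-1) σ)
    (hβ : β ∈ Set.Ioo (-1) σ) (hγ : γ = (1 + α + β - σ) / p) (hτ1 : τ < 1) :
    ∫⁻ t in Set.Ioo (0 : ℝ) τ, ENNReal.ofReal ((t ^ α + t ^ β) *
      (|1 - t ^ (-γ)| ^ (p - 1) * min 1 (t ^ (-γ))) / (1 - t) ^ (1 + σ)) < ∞ := by
  have hτ : 0 < 1 - τ := sub_pos.2 hτ1
  have hp0 : 0 < p := by linarith
  calc ∫⁻ t in Set.Ioo (0 : ℝ) τ, ENNReal.ofReal ((t ^ α + t ^ β) *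
      (|1 - t ^ (-γ)| ^ (p - 1) * min 1 (t ^ (-γ))) / (1 - t) ^ (1 + σ))
      ≤ ∫⁻ t in Set.Ioo (0 : ℝ) τ, ENNReal.ofReal (((1 - τ) ^ (1 + σ))⁻¹) *
        (ENNReal.ofReal (t ^ α) + ENNReal.ofReal (t ^ β) +
         ENNReal.ofReal (t ^ (σ - 1 - β)) + ENNReal.ofReal (t ^ (σ - 1 - α))) := by
        refine setLIntegral_mono' measurableSet_Ioo fun t ht => ?_
        have h1 : 0 < 1 - t := by linarith [ht.2]
        have h0 : 0 < t := ht.1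
        rw [← ENNReal.ofReal_add (by positivity) (by positivity),
          ← ENNReal.ofReal_add (by positivity) (by positivity),
          ← ENNReal.ofReal_add (by positivity) (by positivity), ← ENNReal.ofReal_mul (by positivity)]
        apply ENNReal.ofReal_le_ofReal
        have hz : 0 < t ^ (-γ * p) := by positivity
        have e1 : |1 - t ^ (-γ)| ^ (p - 1) * min 1 (t ^ (-γ)) ≤ 1 + t ^ (-γ * p) := by
          have hm0 : 0 ≤ min 1 (t ^ (-γ)) := le_min zero_le_one (by positivity)
          rcases le_total (t ^ (-γ)) 1 with h | h
          · have : |1 - t ^ (-γ)| ^ (p - 1) ≤ 1 := by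
              apply Real.rpow_le_one (abs_nonneg _) _ (by linarith)
              rw [abs_of_nonneg (by linarith)]
              linarith [Real.rpow_pos_of_pos h0 (-γ)]
            have := mul_le_one₀ this hm0 (min_le_left _ _)
            linarith
          · have : |1 - t ^ (-γ)| ^ (p - 1) ≤ (t ^ (-γ)) ^ p := by
              refine (Real.rpow_le_rpow (abs_nonneg _) (?_ : _ ≤ t ^ (-γ)) (by linarith)).trans
                (Real.rpow_le_rpow_of_exponent_le h (by linarith))
              rw [abs_of_nonpos (by linarith)]; linarith
            rw [← Real.rpow_mul h0.le] at this
            have := mul_le_mul this (min_le_left 1 (t ^ (-γ))) hm0 hz.le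
            linarith
        have e2 : t ^ α * t ^ (-γ * p) = t ^ (σ - 1 - β) := by
          rw [← Real.rpow_add h0]; congr 1; rw [hγ]; field_simp; ring
        have e3 : t ^ β * t ^ (-γ * p) = t ^ (σ - 1 - α) := by
          rw [← Real.rpow_add h0]; congr 1; rw [hγ]; field_simp; ring
        have e4 : (1 - τ) ^ (1 + σ) ≤ (1 - t) ^ (1 + σ) :=
          Real.rpow_le_rpow hτ.le (by linarith [ht.2]) (by linarith)
        rw [← e2, ← e3, div_eq_inv_mul]
        calc ((1 - t) ^ (1 + σ))⁻¹ * ((t ^ α + t ^ β) *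
              (|1 - t ^ (-γ)| ^ (p - 1) * min 1 (t ^ (-γ))))
            ≤ ((1 - τ) ^ (1 + σ))⁻¹ * ((t ^ α + t ^ β) * (1 + t ^ (-γ * p))) := by gcongr
          _ = _ := by ring
    _ ≤ ∫⁻ t in Set.Ioo (0 : ℝ) 1, ENNReal.ofReal (((1 - τ) ^ (1 + σ))⁻¹) *
        (ENNReal.ofReal (t ^ α) + ENNReal.ofReal (t ^ β) +
         ENNReal.ofReal (t ^ (σ - 1 - β)) + ENNReal.ofReal (t ^ (σ - 1 - α))) :=
        lintegral_mono_set (Set.Ioo_subset_Ioo_right hτ1.le)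
    _ < ∞ := by
        rw [lintegral_const_mul _ (by fun_prop), lintegral_add_left (by fun_prop),
          lintegral_add_left (by fun_prop), lintegral_add_left (by fun_prop)]
        refine ENNReal.mul_lt_top ENNReal.ofReal_lt_top ?_
        simp only [ENNReal.add_lt_top]
        exact ⟨⟨⟨setLIntegral_rpow_lt_top hα.1, setLIntegral_rpow_lt_top hβ.1⟩,
          setLIntegral_rpow_lt_top (by linarith [hβ.2])⟩,
          setLIntegral_rpow_lt_top (by linarith [hα.2])⟩

/-! ### Slicing by height and integrating out the horizontal variables -/

/-- The first `n` coordinates of a point of `ℝ^{n+1}`. -/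
noncomputable def horizontalPart (n : ℕ) (y : EuclideanSpace ℝ (Fin (n + 1))) :
    EuclideanSpace ℝ (Fin n) :=
  WithLp.toLp 2 fun i => y i.castSucc

theorem measurePreserving_slice (n : ℕ) :
    MeasurePreserving (fun y : EuclideanSpace ℝ (Fin (n + 1)) =>
      (y (Fin.last n), horizontalPart n y)) volume (volume.prod volume) := by
  have h1 := PiLp.volume_preserving_ofLp (Fin (n + 1))
  have h2 := volume_preserving_piFinSuccAbove (fun _ : Fin (n + 1) => ℝ) (Fin.last n)
  have h3 := (MeasurePreserving.id (volume : Measure ℝ)).prod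
    (PiLp.volume_preserving_toLp (Fin n))
  have h := h3.comp (h2.comp h1)
  have e : (fun y : EuclideanSpace ℝ (Fin (n + 1)) => (y (Fin.last n), horizontalPart n y)) =
      (Prod.map id (WithLp.toLp 2) ∘ (MeasurableEquiv.piFinSuccAbove (fun _ => ℝ) (Fin.last n)) ∘
        WithLp.ofLp) := by
    funext y
    refine Prod.ext rfl ?_
    ext i
    simp [horizontalPart, MeasurableEquiv.piFinSuccAbove, Fin.insertNthEquiv]
    rfl
  rw [e]
  exact h

theorem lintegral_slice (n : ℕ) {F : ℝ × EuclideanSpace ℝ (Fin n) → ℝ≥0∞} (hF : Measurable F) :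
    ∫⁻ y : EuclideanSpace ℝ (Fin (n + 1)), F (y (Fin.last n), horizontalPart n y) =
      ∫⁻ t, ∫⁻ z, F (t, z) := by
  rw [(measurePreserving_slice n).lintegral_comp hF, lintegral_prod _ hF.aemeasurable]

theorem norm_sub_sq_slice (n : ℕ) (x y : EuclideanSpace ℝ (Fin (n + 1))) :
    ‖x - y‖ ^ 2 = (x (Fin.last n) - y (Fin.last n)) ^ 2 +
      ‖horizontalPart n x - horizontalPart n y‖ ^ 2 := by
  rw [EuclideanSpace.norm_sq_eq, EuclideanSpace.norm_sq_eq, Fin.sum_univ_castSucc, add_comm]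
  simp [horizontalPart]

theorem lintegral_exp_neg_mul_sq_norm (n : ℕ) {b : ℝ} (hb : 0 < b) :
    ∫⁻ z : EuclideanSpace ℝ (Fin n), ENNReal.ofReal (Real.exp (-b * ‖z‖ ^ 2)) =
      ENNReal.ofReal ((Real.pi / b) ^ ((n : ℝ) / 2)) := by
  have h := GaussianFourier.integral_rexp_neg_mul_sq_norm (V := EuclideanSpace ℝ (Fin n)) hb
  have hpos : 0 < (Real.pi / b) ^ ((n : ℝ) / 2) := Real.rpow_pos_of_pos (by positivity) _
  rw [finrank_euclideanSpace_fin] at h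
  rw [← h, ofReal_integral_eq_lintegral_ofReal]
  -- The Bochner integral has a positive value, so the integrand is integrable: otherwise the
  -- integral would be `0` by convention.
  · by_contra hc
    rw [integral_undef hc] at h
    exact hpos.ne h
  · exact Filter.Eventually.of_forall fun z => (Real.exp_pos _).le

theorem lintegral_rpow_mul_exp_neg {a r : ℝ} (ha : 0 < a) (hr : 0 < r) :
    ∫⁻ t in Set.Ioi (0 : ℝ), ENNReal.ofReal (t ^ (a - 1) * Real.exp (-(r * t))) =
      ENNReal.ofReal (r ^ (-a) * Real.Gamma a) := by
  have h := Real.integral_rpow_mul_exp_neg_mul_Ioi ha hr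
  have e : (1 / r) ^ a = r ^ (-a) := by
    rw [one_div, Real.inv_rpow hr.le, Real.rpow_neg hr.le]
  rw [e] at h
  have hpos : 0 < r ^ (-a) * Real.Gamma a :=
    mul_pos (Real.rpow_pos_of_pos hr _) (Real.Gamma_pos_of_pos ha)
  rw [← h, ofReal_integral_eq_lintegral_ofReal]
  · by_contra hc
    rw [integral_undef hc] at h
    exact hpos.ne h
  · filter_upwards [ae_restrict_mem measurableSet_Ioi] with t ht
    have : 0 < t := ht
    positivity

/-- Write `Γ(m) A ^ (-m)` as `∫ t ^ (m - 1) exp (-A t) dt`, exchange the integrals, and evaluate the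
Gaussian in `z` and then the Gamma integral in `t`. -/
theorem lintegral_add_sq_norm_rpow (n : ℕ) {σ r : ℝ} (hσ : 0 < σ) (hr : 0 < r) :
    ∫⁻ z : EuclideanSpace ℝ (Fin n),
        ENNReal.ofReal ((r ^ 2 + ‖z‖ ^ 2) ^ (-((((n + 1 : ℕ) : ℝ) + σ) / 2))) =
      ENNReal.ofReal (Real.pi ^ ((((n + 1 : ℕ) : ℝ) - 1) / 2) * Real.Gamma ((1 + σ) / 2) /
        Real.Gamma ((((n + 1 : ℕ) : ℝ) + σ) / 2) * r ^ (-(1 + σ))) := by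
  set m := (((n + 1 : ℕ) : ℝ) + σ) / 2 with hm
  have hm0 : 0 < m := by positivity
  have hG : 0 < Real.Gamma m := Real.Gamma_pos_of_pos hm0
  have hG1 : 0 < Real.Gamma ((1 + σ) / 2) := Real.Gamma_pos_of_pos (by positivity)
  have key : ENNReal.ofReal (Real.Gamma m) * ∫⁻ z : EuclideanSpace ℝ (Fin n),
        ENNReal.ofReal ((r ^ 2 + ‖z‖ ^ 2) ^ (-m)) =
      ENNReal.ofReal (Real.pi ^ ((n : ℝ) / 2)) *
        ENNReal.ofReal ((r ^ 2) ^ (-((1 + σ) / 2)) * Real.Gamma ((1 + σ) / 2)) := by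
    rw [← lintegral_const_mul _ (by fun_prop)]
    calc ∫⁻ z : EuclideanSpace ℝ (Fin n), ENNReal.ofReal (Real.Gamma m) *
          ENNReal.ofReal ((r ^ 2 + ‖z‖ ^ 2) ^ (-m))
        = ∫⁻ z : EuclideanSpace ℝ (Fin n), ∫⁻ t in Set.Ioi (0 : ℝ),
            ENNReal.ofReal (t ^ (m - 1) * Real.exp (-((r ^ 2 + ‖z‖ ^ 2) * t))) := by
          refine lintegral_congr fun z => ?_
          rw [lintegral_rpow_mul_exp_neg hm0 (by positivity), ← ENNReal.ofReal_mul hG.le, mul_comm]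
      _ = ∫⁻ t in Set.Ioi (0 : ℝ), ∫⁻ z : EuclideanSpace ℝ (Fin n),
            ENNReal.ofReal (t ^ (m - 1) * Real.exp (-((r ^ 2 + ‖z‖ ^ 2) * t))) := by
          rw [lintegral_lintegral_swap]
          apply Measurable.aemeasurable
          fun_prop
      _ = ∫⁻ t in Set.Ioi (0 : ℝ), ENNReal.ofReal (Real.pi ^ ((n : ℝ) / 2)) *
            ENNReal.ofReal (t ^ ((1 + σ) / 2 - 1) * Real.exp (-(r ^ 2 * t))) := by
          refine setLIntegral_congr_fun measurableSet_Ioi fun t ht => ?_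
          have ht0 : 0 < t := ht
          have e1 : ∀ z : EuclideanSpace ℝ (Fin n),
              ENNReal.ofReal (t ^ (m - 1) * Real.exp (-((r ^ 2 + ‖z‖ ^ 2) * t))) =
              ENNReal.ofReal (t ^ (m - 1) * Real.exp (-(r ^ 2 * t))) *
                ENNReal.ofReal (Real.exp (-t * ‖z‖ ^ 2)) := by
            intro z
            rw [← ENNReal.ofReal_mul (by positivity), mul_assoc, ← Real.exp_add]
            congr 3; ring
          simp only [e1]
          rw [lintegral_const_mul _ (by fun_prop), lintegral_exp_neg_mul_sq_norm n ht0,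
            ← ENNReal.ofReal_mul (by positivity), ← ENNReal.ofReal_mul (by positivity),
            Real.div_rpow Real.pi_pos.le ht0.le]
          congr 1
          have e2 : t ^ (m - 1) = t ^ ((1 + σ) / 2 - 1) * t ^ ((n : ℝ) / 2) := by
            rw [← Real.rpow_add ht0]; congr 1; rw [hm]; push_cast; ring
          rw [e2]; field_simp
      _ = _ := by
          rw [lintegral_const_mul _ (by fun_prop),
            lintegral_rpow_mul_exp_neg (by positivity) (by positivity)]
  have hGne : ENNReal.ofReal (Real.Gamma m) ≠ 0 := by simpa using hG
  rw [← ENNReal.mul_right_inj hGne ENNReal.ofReal_ne_top, key, ← ENNReal.ofReal_mul (by positivity),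
    ← ENNReal.ofReal_mul hG.le]
  congr 1
  rw [← Real.rpow_natCast, ← Real.rpow_mul hr.le]
  have e3 : ((2 : ℕ) : ℝ) * -((1 + σ) / 2) = -(1 + σ) := by push_cast; ring
  have e4 : (((n + 1 : ℕ) : ℝ) - 1) / 2 = (n : ℝ) / 2 := by push_cast; ring
  rw [e3, e4]
  field_simp

theorem norm_rpow_neg_eq (n : ℕ) (x y : EuclideanSpace ℝ (Fin (n + 1))) (m : ℝ) :
    ‖x - y‖ ^ (-m) = ((x (Fin.last n) - y (Fin.last n)) ^ 2 +
      ‖horizontalPart n x - horizontalPart n y‖ ^ 2) ^ (-(m / 2)) := by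
  rw [← norm_sub_sq_slice, ← Real.rpow_natCast, ← Real.rpow_mul (norm_nonneg _)]
  congr 1; push_cast; ring

/-- Integrating out the horizontal variables in the kernel `|x - y|^{-(d+σ)}`. -/
theorem lintegral_mul_norm_rpow_neg (n : ℕ) {σ : ℝ} (hσ : 0 < σ)
    (x : EuclideanSpace ℝ (Fin (n + 1))) {g : ℝ → ℝ≥0∞} (hg : Measurable g) :
    ∫⁻ y : EuclideanSpace ℝ (Fin (n + 1)),
        g (y (Fin.last n)) * ENNReal.ofReal (‖x - y‖ ^ (-(((n + 1 : ℕ) : ℝ) + σ))) =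
      ENNReal.ofReal (Real.pi ^ ((((n + 1 : ℕ) : ℝ) - 1) / 2) * Real.Gamma ((1 + σ) / 2) /
        Real.Gamma ((((n + 1 : ℕ) : ℝ) + σ) / 2)) *
      ∫⁻ t, g t * ENNReal.ofReal (|x (Fin.last n) - t| ^ (-(1 + σ))) := by
  have hG : 0 < Real.Gamma ((((n + 1 : ℕ) : ℝ) + σ) / 2) := Real.Gamma_pos_of_pos (by positivity)
  have hG1 : 0 < Real.Gamma ((1 + σ) / 2) := Real.Gamma_pos_of_pos (by positivity)
  simp only [norm_rpow_neg_eq]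
  rw [lintegral_slice n (F := fun q => g q.1 * ENNReal.ofReal (((x (Fin.last n) - q.1) ^ 2 +
    ‖horizontalPart n x - q.2‖ ^ 2) ^ (-((((n + 1 : ℕ) : ℝ) + σ) / 2)))) (by fun_prop),
    ← lintegral_const_mul _ (by fun_prop)]
  refine lintegral_congr_ae ?_
  have hne : ∀ᵐ t : ℝ, t ≠ x (Fin.last n) := by
    simp [ae_iff, measure_singleton]
  filter_upwards [hne] with t ht
  have hr : 0 < |x (Fin.last n) - t| := abs_pos.2 (sub_ne_zero.2 ht.symm)
  rw [lintegral_const_mul _ (by fun_prop),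
    lintegral_sub_left_eq_self (fun z : EuclideanSpace ℝ (Fin n) =>
      ENNReal.ofReal (((x (Fin.last n) - t) ^ 2 + ‖z‖ ^ 2) ^ (-((((n + 1 : ℕ) : ℝ) + σ) / 2))))
      (horizontalPart n x), ← sq_abs (x (Fin.last n) - t),
    lintegral_add_sq_norm_rpow n hσ hr, ENNReal.ofReal_mul (by positivity)]
  ring

/-! ### The symmetrized kernel and its integrals in the height ratio -/

/-- The normalizing constant `π^{(d-1)/2} Γ((1+σ)/2) / Γ((d+σ)/2)`. -/
noncomputable def sliceConst (d : ℕ) (σ : ℝ) : ℝ≥0∞ :=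
  ENNReal.ofReal (Real.pi ^ (((d : ℝ) - 1) / 2) * Real.Gamma ((1 + σ) / 2) /
      Real.Gamma (((d : ℝ) + σ) / 2))

/-- The symmetrized weighted kernel `(x_d^α y_d^β + x_d^β y_d^α) |x - y|^{-(d+σ)}`. -/
noncomputable def symKernel (n : ℕ) (α β σ : ℝ) (x y : EuclideanSpace ℝ (Fin (n + 1))) : ℝ :=
  (x (Fin.last n) ^ α * y (Fin.last n) ^ β + x (Fin.last n) ^ β * y (Fin.last n) ^ α) *
    ‖x - y‖ ^ (-(((n + 1 : ℕ) : ℝ) + σ))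

theorem measurable_last (n : ℕ) :
    Measurable fun x : EuclideanSpace ℝ (Fin (n + 1)) => x (Fin.last n) := by fun_prop

theorem symKernel_comm (n : ℕ) (α β σ : ℝ) (x y : EuclideanSpace ℝ (Fin (n + 1))) :
    symKernel n α β σ x y = symKernel n α β σ y x := by
  unfold symKernel
  rw [norm_sub_rev]; ring

theorem measurable_symKernel (n : ℕ) (α β σ : ℝ) :
    Measurable fun q : EuclideanSpace ℝ (Fin (n + 1)) × EuclideanSpace ℝ (Fin (n + 1)) =>
      symKernel n α β σ q.1 q.2 := by
  unfold symKernel; fun_prop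

theorem lintegral_symKernel_slice (n : ℕ) {α β σ : ℝ} (hσ : 0 < σ)
    (x : EuclideanSpace ℝ (Fin (n + 1))) (hx : 0 < x (Fin.last n)) {S : Set ℝ}
    (hS : MeasurableSet S) (hS0 : S ⊆ Set.Ioi 0) {φ : ℝ → ℝ≥0∞} (hφ : Measurable φ) :
    ∫⁻ y in {y : EuclideanSpace ℝ (Fin (n + 1)) | y (Fin.last n) ∈ S},
        φ (y (Fin.last n)) * ENNReal.ofReal (symKernel n α β σ x y) =
      sliceConst (n + 1) σ * ∫⁻ r in S, φ r * ENNReal.ofReal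
        ((x (Fin.last n) ^ α * r ^ β + x (Fin.last n) ^ β * r ^ α) *
          |x (Fin.last n) - r| ^ (-(1 + σ))) := by
  have hS' : MeasurableSet {y : EuclideanSpace ℝ (Fin (n + 1)) | y (Fin.last n) ∈ S} :=
    measurable_last n hS
  have key := lintegral_mul_norm_rpow_neg n hσ x (g := S.indicator fun r => φ r * ENNReal.ofReal
    (x (Fin.last n) ^ α * r ^ β + x (Fin.last n) ^ β * r ^ α))
    (Measurable.indicator (by fun_prop) hS)
  rw [← lintegral_indicator hS', ← lintegral_indicator hS]
  refine Eq.trans (lintegral_congr fun y => ?_) (key.trans ?_)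
  · by_cases hy : y (Fin.last n) ∈ S
    · have hy0 : 0 < y (Fin.last n) := hS0 hy
      rw [Set.indicator_of_mem (show y ∈ {y : EuclideanSpace ℝ (Fin (n + 1)) |
        y (Fin.last n) ∈ S} from hy), Set.indicator_of_mem hy, mul_assoc,
        ← ENNReal.ofReal_mul (by positivity)]
      rfl
    · rw [Set.indicator_of_notMem (show y ∉ {y : EuclideanSpace ℝ (Fin (n + 1)) |
        y (Fin.last n) ∈ S} from hy), Set.indicator_of_notMem hy, zero_mul]
  · unfold sliceConst
    congr 1
    refine lintegral_congr fun r => ?_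
    by_cases hr : r ∈ S
    · have hr0 : 0 < r := hS0 hr
      rw [Set.indicator_of_mem hr, Set.indicator_of_mem hr, mul_assoc,
        ← ENNReal.ofReal_mul (by positivity)]
    · rw [Set.indicator_of_notMem hr, Set.indicator_of_notMem hr, zero_mul]

theorem setLIntegral_Ioo_scale {h τ : ℝ} (hh : 0 < h) (g : ℝ → ℝ≥0∞) :
    ∫⁻ r in Set.Ioo 0 (τ * h), g r = ∫⁻ t in Set.Ioo 0 τ, ENNReal.ofReal h * g (t * h) := by
  have e : Set.Ioo 0 (τ * h) = Set.image (fun t => t * h) (Set.Ioo 0 τ) := by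
    rw [Set.image_mul_right_Ioo _ _ hh, zero_mul]
  rw [e, lintegral_image_eq_lintegral_abs_deriv_mul (f := fun t => t * h) (f' := fun _ => h)
    measurableSet_Ioo (fun t _ => ((hasDerivAt_id t).mul_const h).congr_deriv (one_mul h) |>.hasDerivWithinAt)
    (fun a _ b _ hab => mul_right_cancel₀ hh.ne' hab), abs_of_pos hh]

theorem setLIntegral_Ioi_inversion {h τ : ℝ} (hh : 0 < h) (hτ : 0 < τ) (g : ℝ → ℝ≥0∞) :
    ∫⁻ r in Set.Ioi (h / τ), g r =
      ∫⁻ t in Set.Ioo 0 τ, ENNReal.ofReal (h / t ^ 2) * g (h / t) := by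
  have e : Set.Ioi (h / τ) = Set.image (fun t => h / t) (Set.Ioo 0 τ) := by
    ext r
    constructor
    · intro hr
      have hr' : h / τ < r := hr
      have hr0 : 0 < r := lt_trans (by positivity) hr'
      refine ⟨h / r, ⟨by positivity, ?_⟩, ?_⟩
      · rw [div_lt_iff₀ hτ] at hr'
        rw [div_lt_iff₀ hr0]; linarith
      · show h / (h / r) = r
        field_simp
    · rintro ⟨t, ht, rfl⟩
      exact div_lt_div_of_pos_left hh ht.1 ht.2
  rw [e, lintegral_image_eq_lintegral_abs_deriv_mul (f' := fun t => -(h / t ^ 2))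
    measurableSet_Ioo]
  · refine setLIntegral_congr_fun measurableSet_Ioo fun t ht => ?_
    rw [abs_neg, abs_of_nonneg (by positivity)]
  · intro t ht
    have := (hasDerivAt_inv ht.1.ne').const_mul h
    refine HasDerivAt.hasDerivWithinAt ?_
    refine this.congr_deriv ?_
    rw [mul_neg, div_eq_mul_inv]
  · intro a ha b hb hab
    have ha0 := ha.1.ne'
    have hb0 := hb.1.ne'
    simp only at hab
    field_simp at hab
    exact hab.symm

/-- Slice and substitute `y_d = t * x_d`; homogeneity pulls out the Hardy weight `x_d ^ (α + β -
σ)`. -/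
theorem lintegral_symKernel_below (n : ℕ) {α β σ τ : ℝ} (hσ : 0 < σ) (hτ1 : τ ≤ 1)
    (x : EuclideanSpace ℝ (Fin (n + 1))) (hx : 0 < x (Fin.last n)) {φ : ℝ → ℝ≥0∞}
    (hφ : Measurable φ) :
    ∫⁻ y in {y : EuclideanSpace ℝ (Fin (n + 1)) | y (Fin.last n) ∈ Set.Ioo 0 (τ * x (Fin.last n))},
        φ (y (Fin.last n) / x (Fin.last n)) * ENNReal.ofReal (symKernel n α β σ x y) =
      sliceConst (n + 1) σ * (ENNReal.ofReal (x (Fin.last n) ^ (α + β - σ)) *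
        ∫⁻ t in Set.Ioo 0 τ, φ t * ENNReal.ofReal ((t ^ α + t ^ β) / (1 - t) ^ (1 + σ))) := by
  rw [lintegral_symKernel_slice n hσ x hx measurableSet_Ioo (fun r hr => hr.1)
    (φ := fun r => φ (r / x (Fin.last n))) (by fun_prop), setLIntegral_Ioo_scale hx,
    ← lintegral_const_mul (ENNReal.ofReal (x (Fin.last n) ^ (α + β - σ))) (by fun_prop)]
  congr 1
  refine setLIntegral_congr_fun measurableSet_Ioo fun t ht => ?_
  set h := x (Fin.last n)
  have ht0 : 0 < t := ht.1
  have ht1 : 0 < 1 - t := by linarith [ht.2]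
  simp only
  rw [mul_div_cancel_right₀ _ hx.ne', mul_left_comm, mul_left_comm _ (φ t),
    ← ENNReal.ofReal_mul hx.le, ← ENNReal.ofReal_mul (by positivity)]
  congr 2
  have e1 : |h - t * h| = h * (1 - t) := by
    rw [show h - t * h = h * (1 - t) by ring, abs_of_pos (by positivity)]
  rw [e1, Real.mul_rpow hx.le ht1.le, Real.mul_rpow ht0.le hx.le, Real.mul_rpow ht0.le hx.le,
    Real.rpow_neg ht1.le]
  have e2 : h ^ (α + β - σ) = h * (h ^ α * h ^ β) * h ^ (-(1 + σ)) := by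
    rw [← Real.rpow_add hx, mul_comm h, ← Real.rpow_add_one hx.ne', ← Real.rpow_add hx]
    congr 1; ring
  rw [e2]
  field_simp
  ring

/-- The substitution is `x_d = y_d / t`, so `t` is again the ratio of the lower to the upper height
and the result can be compared with the integral over lower points. -/
theorem lintegral_symKernel_above (n : ℕ) {α β σ τ : ℝ} (hσ : 0 < σ) (hτ : 0 < τ) (hτ1 : τ ≤ 1)
    (y : EuclideanSpace ℝ (Fin (n + 1))) (hy : 0 < y (Fin.last n)) {φ : ℝ → ℝ≥0∞}
    (hφ : Measurable φ) :
    ∫⁻ x in {x : EuclideanSpace ℝ (Fin (n + 1)) | x (Fin.last n) ∈ Set.Ioi (y (Fin.last n) / τ)},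
        φ (y (Fin.last n) / x (Fin.last n)) * ENNReal.ofReal (symKernel n α β σ x y) =
      sliceConst (n + 1) σ * (ENNReal.ofReal (y (Fin.last n) ^ (α + β - σ)) *
        ∫⁻ t in Set.Ioo 0 τ, φ t * ENNReal.ofReal ((t ^ (-α) + t ^ (-β)) * t ^ (σ - 1) /
          (1 - t) ^ (1 + σ))) := by
  simp only [symKernel_comm n α β σ _ y]
  rw [lintegral_symKernel_slice n hσ y hy measurableSet_Ioi
    (fun r hr => lt_trans (by positivity) (Set.mem_Ioi.1 hr))
    (φ := fun r => φ (y (Fin.last n) / r)) (by fun_prop), setLIntegral_Ioi_inversion hy hτ,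
    ← lintegral_const_mul (ENNReal.ofReal (y (Fin.last n) ^ (α + β - σ))) (by fun_prop)]
  congr 1
  refine setLIntegral_congr_fun measurableSet_Ioo fun t ht => ?_
  set h := y (Fin.last n)
  have ht0 : 0 < t := ht.1
  have ht1 : 0 < 1 - t := by linarith [ht.2]
  simp only
  rw [show h / (h / t) = t by field_simp, mul_left_comm, mul_left_comm _ (φ t),
    ← ENNReal.ofReal_mul (by positivity), ← ENNReal.ofReal_mul (by positivity)]
  congr 2
  have e1 : |h - h / t| = h * (1 - t) / t := by
    rw [abs_sub_comm, show h / t - h = h * (1 - t) / t by field_simp, abs_of_pos (by positivity)]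
  rw [e1, Real.div_rpow (mul_nonneg hy.le ht1.le) ht0.le, Real.mul_rpow hy.le ht1.le,
    Real.div_rpow hy.le ht0.le, Real.div_rpow hy.le ht0.le, Real.rpow_neg ht1.le,
    Real.rpow_neg ht0.le, Real.rpow_neg ht0.le, Real.rpow_neg ht0.le]
  have e2 : h ^ (α + β - σ) = h * (h ^ α * h ^ β) * h ^ (-(1 + σ)) := by
    rw [← Real.rpow_add hy, mul_comm h, ← Real.rpow_add_one hy.ne', ← Real.rpow_add hy]
    congr 1; ring
  have e3 : t ^ (1 + σ) = t ^ (σ - 1) * t ^ 2 := by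
    rw [← Real.rpow_natCast, ← Real.rpow_add ht0]; congr 1; push_cast; ring
  rw [e2, e3]
  field_simp
  ring

/-! ### The pointwise inequality for powers of the height -/

theorem sub_rpow_mul_rpow_eq {p W w U : ℝ} (hw : 0 < w) (hwW : w ≤ W) :
    (W - w) ^ (p - 1) * W * |U / W| ^ p = |U| ^ p * |1 - w / W| ^ (p - 1) := by
  have hW : 0 < W := hw.trans_le hwW
  have e : 1 - w / W = (W - w) / W := by field_simp
  rw [e, abs_of_nonneg (div_nonneg (sub_nonneg.2 hwW) hW.le), abs_div, abs_of_pos hW,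
    Real.div_rpow (abs_nonneg _) hW.le, Real.div_rpow (sub_nonneg.2 hwW) hW.le,
    Real.rpow_sub_one hW.ne']
  field_simp

theorem sub_rpow_mul_rpow_eq' {p W w U : ℝ} (hw : 0 < w) (hwW : w ≤ W) :
    (W - w) ^ (p - 1) * w * |U / w| ^ p = |U| ^ p * |1 - W / w| ^ (p - 1) := by
  have e : 1 - W / w = -((W - w) / w) := by field_simp; ring
  rw [e, abs_neg, abs_of_nonneg (div_nonneg (sub_nonneg.2 hwW) hw.le), abs_div, abs_of_pos hw,
    Real.div_rpow (abs_nonneg _) hw.le, Real.div_rpow (sub_nonneg.2 hwW) hw.le,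
    Real.rpow_sub_one hw.ne']
  field_simp

theorem div_rpow_neg_eq {X Y γ : ℝ} (hX : 0 < X) (hY : 0 < Y) :
    Y ^ (-γ) / X ^ (-γ) = (Y / X) ^ (-γ) := (Real.div_rpow hY.le hX.le _).symm

theorem div_rpow_neg_eq' {X Y γ : ℝ} (hX : 0 < X) (hY : 0 < Y) :
    X ^ (-γ) / Y ^ (-γ) = (Y / X) ^ γ := by
  rw [div_rpow_neg_eq hY hX, Real.rpow_neg (by positivity), ← Real.inv_rpow (by positivity),
    inv_div]

/-- `groundState_pointwise` with the ground state values `X ^ (-γ)` and `Y ^ (-γ)` as weights; here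
the upper point has the larger one. -/
theorem groundState_pointwise_nonpos {p γ X Y U V : ℝ} (hp : 2 ≤ p) (hγ : γ ≤ 0) (hY : 0 < Y)
    (hYX : Y ≤ X) :
    |U| ^ p * |1 - (Y / X) ^ (-γ)| ^ (p - 1) + (2 ^ (1 - p)) ^ 2 *
        ((X * Y) ^ (-(γ * p / 2)) * |U * X ^ γ - V * Y ^ γ| ^ p) ≤
      |U - V| ^ p + |V| ^ p * |1 - (Y / X) ^ γ| ^ (p - 1) := by
  have hX : 0 < X := hY.trans_le hYX
  have hw : 0 < Y ^ (-γ) := by positivity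
  have hW : 0 < X ^ (-γ) := by positivity
  have hwW : Y ^ (-γ) ≤ X ^ (-γ) := Real.rpow_le_rpow hY.le hYX (by linarith)
  have h := groundState_pointwise hp hw hwW (U / X ^ (-γ)) (V / Y ^ (-γ))
  rw [sub_rpow_mul_rpow_eq hw hwW, sub_rpow_mul_rpow_eq' hw hwW, div_rpow_neg_eq hX hY,
    div_rpow_neg_eq' hX hY, mul_div_cancel₀ _ hW.ne', mul_div_cancel₀ _ hw.ne'] at h
  have e1 : (X ^ (-γ) * Y ^ (-γ)) ^ (p / 2) = (X * Y) ^ (-(γ * p / 2)) := by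
    rw [← Real.mul_rpow hX.le hY.le, ← Real.rpow_mul (by positivity)]; congr 1; ring
  have e2 : ∀ A B : ℝ, 0 < B → A / B ^ (-γ) = A * B ^ γ := by
    intro A B hB; rw [Real.rpow_neg hB.le, div_inv_eq_mul]
  rw [e1, e2 _ _ hX, e2 _ _ hY] at h
  linarith

/-- Now the ground state decreases in the height, so the lower point has the larger weight and the
two points exchange roles. -/
theorem groundState_pointwise_nonneg {p γ X Y U V : ℝ} (hp : 2 ≤ p) (hγ : 0 ≤ γ) (hY : 0 < Y)
    (hYX : Y ≤ X) :
    |V| ^ p * |1 - (Y / X) ^ γ| ^ (p - 1) + (2 ^ (1 - p)) ^ 2 *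
        ((X * Y) ^ (-(γ * p / 2)) * |U * X ^ γ - V * Y ^ γ| ^ p) ≤
      |U - V| ^ p + |U| ^ p * |1 - (Y / X) ^ (-γ)| ^ (p - 1) := by
  have hX : 0 < X := hY.trans_le hYX
  have hw : 0 < X ^ (-γ) := by positivity
  have hW : 0 < Y ^ (-γ) := by positivity
  have hwW : X ^ (-γ) ≤ Y ^ (-γ) := Real.rpow_le_rpow_of_nonpos hY hYX (by linarith)
  have h := groundState_pointwise hp hw hwW (V / Y ^ (-γ)) (U / X ^ (-γ))
  rw [sub_rpow_mul_rpow_eq hw hwW, sub_rpow_mul_rpow_eq' hw hwW, div_rpow_neg_eq hX hY,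
    div_rpow_neg_eq' hX hY, mul_div_cancel₀ _ hW.ne', mul_div_cancel₀ _ hw.ne'] at h
  have e1 : (Y ^ (-γ) * X ^ (-γ)) ^ (p / 2) = (X * Y) ^ (-(γ * p / 2)) := by
    rw [mul_comm, ← Real.mul_rpow hX.le hY.le, ← Real.rpow_mul (by positivity)]; congr 1; ring
  have e2 : ∀ A B : ℝ, 0 < B → A / B ^ (-γ) = A * B ^ γ := by
    intro A B hB; rw [Real.rpow_neg hB.le, div_inv_eq_mul]
  rw [e1, e2 _ _ hX, e2 _ _ hY, abs_sub_comm (V * Y ^ γ), abs_sub_comm V] at h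
  linarith

/-! ### The ground state representation on truncated pairs -/

/-- Pairs of points of the half-space, the second at a height below `τ` times that of the first. -/
def belowPairs (n : ℕ) (τ : ℝ) :
    Set (EuclideanSpace ℝ (Fin (n + 1)) × EuclideanSpace ℝ (Fin (n + 1))) :=
  {q | 0 < q.1 (Fin.last n) ∧ q.2 (Fin.last n) ∈ Set.Ioo 0 (τ * q.1 (Fin.last n))}

theorem measurableSet_belowPairs (n : ℕ) (τ : ℝ) : MeasurableSet (belowPairs n τ) := by
  have h1 : Measurable fun q : EuclideanSpace ℝ (Fin (n + 1)) × EuclideanSpace ℝ (Fin (n + 1)) =>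
    q.1 (Fin.last n) := by fun_prop
  have h2 : Measurable fun q : EuclideanSpace ℝ (Fin (n + 1)) × EuclideanSpace ℝ (Fin (n + 1)) =>
    q.2 (Fin.last n) := by fun_prop
  exact (measurableSet_lt measurable_const h1).inter
    ((measurableSet_lt measurable_const h2).inter (measurableSet_lt h2 (h1.const_mul τ)))

theorem measurableSet_halfSpace (n : ℕ) : MeasurableSet (halfSpace n) :=
  measurableSet_lt measurable_const (measurable_last n)

theorem setLIntegral_belowPairs (n : ℕ) {τ : ℝ}
    {F : EuclideanSpace ℝ (Fin (n + 1)) × EuclideanSpace ℝ (Fin (n + 1)) → ℝ≥0∞}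
    (hF : Measurable F) :
    ∫⁻ q in belowPairs n τ, F q = ∫⁻ x in halfSpace n, ∫⁻ y in
      {y : EuclideanSpace ℝ (Fin (n + 1)) | y (Fin.last n) ∈ Set.Ioo 0 (τ * x (Fin.last n))},
        F (x, y) := by
  rw [← lintegral_indicator (measurableSet_belowPairs n τ), Measure.volume_eq_prod,
    lintegral_prod _ (hF.indicator (measurableSet_belowPairs n τ)).aemeasurable,
    ← lintegral_indicator (measurableSet_halfSpace n)]
  refine lintegral_congr fun x => ?_
  by_cases hx : x ∈ halfSpace n
  · have hm : MeasurableSet {y : EuclideanSpace ℝ (Fin (n + 1)) | y (Fin.last n) ∈ Set.Ioo 0 (τ * x (Fin.last n))} :=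
      measurable_last n measurableSet_Ioo
    rw [Set.indicator_of_mem hx, ← lintegral_indicator hm]
    refine lintegral_congr fun y => ?_
    have hx' : 0 < x (Fin.last n) := hx
    simp [Set.indicator, belowPairs, hx']
  · rw [Set.indicator_of_notMem hx]
    have hx' : ¬ 0 < x (Fin.last n) := hx
    simp [Set.indicator, belowPairs, hx']

theorem setLIntegral_belowPairs_swap (n : ℕ) {τ : ℝ} (hτ : 0 < τ)
    {F : EuclideanSpace ℝ (Fin (n + 1)) × EuclideanSpace ℝ (Fin (n + 1)) → ℝ≥0∞}
    (hF : Measurable F) :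
    ∫⁻ q in belowPairs n τ, F q = ∫⁻ y in halfSpace n, ∫⁻ x in
      {x : EuclideanSpace ℝ (Fin (n + 1)) | x (Fin.last n) ∈ Set.Ioi (y (Fin.last n) / τ)},
        F (x, y) := by
  rw [← lintegral_indicator (measurableSet_belowPairs n τ), Measure.volume_eq_prod,
    lintegral_prod_symm _ (hF.indicator (measurableSet_belowPairs n τ)).aemeasurable,
    ← lintegral_indicator (measurableSet_halfSpace n)]
  refine lintegral_congr fun y => ?_
  by_cases hy : y ∈ halfSpace n
  · have hm : MeasurableSet {x : EuclideanSpace ℝ (Fin (n + 1)) | x (Fin.last n) ∈ Set.Ioi (y (Fin.last n) / τ)} :=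
      measurable_last n measurableSet_Ioi
    rw [Set.indicator_of_mem hy, ← lintegral_indicator hm]
    refine lintegral_congr fun x => ?_
    have hy' : 0 < y (Fin.last n) := hy
    have : (x, y) ∈ belowPairs n τ ↔
        x ∈ {x : EuclideanSpace ℝ (Fin (n + 1)) | x (Fin.last n) ∈
          Set.Ioi (y (Fin.last n) / τ)} := by
      simp only [belowPairs, Set.mem_ofPred_eq, Set.mem_Ioo, Set.mem_Ioi,
        div_lt_iff₀ hτ]
      constructor
      · rintro ⟨_, _, h⟩; linarith
      · intro h
        refine ⟨?_, hy', by linarith⟩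
        exact pos_of_mul_pos_left (hy'.trans h) hτ.le
    by_cases hm : (x, y) ∈ belowPairs n τ
    · rw [Set.indicator_of_mem hm, Set.indicator_of_mem (this.1 hm)]
    · rw [Set.indicator_of_notMem hm, Set.indicator_of_notMem (fun h => hm (this.2 h))]
  · rw [Set.indicator_of_notMem hy]
    have hy' : ¬ 0 < y (Fin.last n) := hy
    simp [Set.indicator, belowPairs, hy']

theorem lintegral_belowPairs_fst (n : ℕ) {s p α β τ : ℝ} (hσ : 0 < s * p) (hτ1 : τ ≤ 1)
    {u : EuclideanSpace ℝ (Fin (n + 1)) → ℝ} (hu : Measurable u) {φ : ℝ → ℝ} (hφ : Measurable φ) :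
    ∫⁻ q in belowPairs n τ, ENNReal.ofReal (|u q.1| ^ p) *
        (ENNReal.ofReal (φ (q.2 (Fin.last n) / q.1 (Fin.last n))) *
          ENNReal.ofReal (symKernel n α β (s * p) q.1 q.2)) =
      sliceConst (n + 1) (s * p) * hardyTerm n s p α β u *
        ∫⁻ t in Set.Ioo 0 τ, ENNReal.ofReal (φ t) *
          ENNReal.ofReal ((t ^ α + t ^ β) / (1 - t) ^ (1 + s * p)) := by
  have hK := measurable_symKernel n α β (s * p)
  rw [setLIntegral_belowPairs n (by fun_prop), hardyTerm, mul_assoc,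
    ← lintegral_mul_const _ (by fun_prop), ← lintegral_const_mul _ (by fun_prop)]
  refine setLIntegral_congr_fun (measurableSet_halfSpace n) fun x hx => ?_
  have hx' : 0 < x (Fin.last n) := hx
  have hKx : Measurable fun y => symKernel n α β (s * p) x y := hK.comp measurable_prodMk_left
  simp only
  rw [lintegral_const_mul _ (by fun_prop), lintegral_symKernel_below n hσ hτ1 x hx'
    (φ := fun t => ENNReal.ofReal (φ t)) (by fun_prop), mul_left_comm, ← mul_assoc (ENNReal.ofReal _),
    ← ENNReal.ofReal_mul (by positivity), div_eq_mul_inv (|u x| ^ p), ← Real.rpow_neg hx'.le]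
  congr 5; ring

theorem lintegral_belowPairs_snd (n : ℕ) {s p α β τ : ℝ} (hσ : 0 < s * p) (hτ : 0 < τ)
    (hτ1 : τ ≤ 1)
    {u : EuclideanSpace ℝ (Fin (n + 1)) → ℝ} (hu : Measurable u) {φ : ℝ → ℝ} (hφ : Measurable φ) :
    ∫⁻ q in belowPairs n τ, ENNReal.ofReal (|u q.2| ^ p) *
        (ENNReal.ofReal (φ (q.2 (Fin.last n) / q.1 (Fin.last n))) *
          ENNReal.ofReal (symKernel n α β (s * p) q.1 q.2)) =
      sliceConst (n + 1) (s * p) * hardyTerm n s p α β u *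
        ∫⁻ t in Set.Ioo 0 τ, ENNReal.ofReal (φ t) *
          ENNReal.ofReal ((t ^ (-α) + t ^ (-β)) * t ^ (s * p - 1) / (1 - t) ^ (1 + s * p)) := by
  have hK := measurable_symKernel n α β (s * p)
  rw [setLIntegral_belowPairs_swap n hτ (by fun_prop), hardyTerm, mul_assoc,
    ← lintegral_mul_const _ (by fun_prop), ← lintegral_const_mul _ (by fun_prop)]
  refine setLIntegral_congr_fun (measurableSet_halfSpace n) fun y hy => ?_
  have hy' : 0 < y (Fin.last n) := hy
  have hKy : Measurable fun x => symKernel n α β (s * p) x y := hK.comp measurable_prodMk_right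
  simp only
  rw [lintegral_const_mul _ (by fun_prop), lintegral_symKernel_above n hσ hτ hτ1 y hy'
    (φ := fun t => ENNReal.ofReal (φ t)) (by fun_prop), mul_left_comm, ← mul_assoc (ENNReal.ofReal _),
    ← ENNReal.ofReal_mul (by positivity), div_eq_mul_inv (|u y| ^ p), ← Real.rpow_neg hy'.le]
  congr 5; ring

/-- This is where the value of `γ` is forced: it makes the weights from the upper and the lower
variable agree up to the factor `t ^ (-γ)`. -/
theorem dual_weight_identity {α β σ p γ t : ℝ} (hp : 0 < p) (hγ : γ = (1 + α + β - σ) / p)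
    (ht : 0 < t) :
    |1 - t ^ γ| ^ (p - 1) * ((t ^ (-α) + t ^ (-β)) * t ^ (σ - 1)) =
      |1 - t ^ (-γ)| ^ (p - 1) * t ^ (-γ) * (t ^ α + t ^ β) := by
  have e1 : |1 - t ^ γ| = t ^ γ * |1 - t ^ (-γ)| := by
    rw [← abs_of_pos (Real.rpow_pos_of_pos ht γ), ← abs_mul, abs_of_pos (Real.rpow_pos_of_pos ht γ),
      mul_sub, ← Real.rpow_add ht, add_neg_cancel, Real.rpow_zero, mul_one, abs_sub_comm]
  have e2 : (t ^ γ) ^ (p - 1) * ((t ^ (-α) + t ^ (-β)) * t ^ (σ - 1)) =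
      t ^ (-γ) * (t ^ α + t ^ β) := by
    rw [← Real.rpow_mul ht.le, mul_add, add_mul, mul_add]
    simp only [← Real.rpow_add ht]
    rw [add_comm]
    congr 2 <;> (rw [hγ]; field_simp; ring)
  rw [e1, Real.mul_rpow (by positivity) (abs_nonneg _), mul_assoc _ (t ^ (-γ)), ← e2]
  ring

/-- The one-dimensional integral of `𝒟` over `(0, τ)`. -/
noncomputable def hardyIntegral (α β σ p γ τ : ℝ) : ℝ≥0∞ :=
  ∫⁻ t in Set.Ioo (0 : ℝ) τ,
    ENNReal.ofReal ((t ^ α + t ^ β) * |1 - t ^ (-γ)| ^ p / (1 - t) ^ (1 + σ))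

theorem abs_rpow_eq_abs_rpow_sub_one_mul {p : ℝ} (hp : 0 < p) (z : ℝ) :
    |z| ^ p = |z| ^ (p - 1) * |z| := by
  rcases eq_or_ne z 0 with rfl | hz
  · simp [Real.zero_rpow hp.ne']
  · rw [← Real.rpow_add_one (abs_pos.2 hz).ne', sub_add_cancel]

/-- By `dual_weight_identity` the two integrands differ by `|1 - t ^ (-γ)| ^ (p - 1) * (1 - t ^
(-γ))` times the common weight, and for `γ ≤ 0` the last factor is its own absolute value. The
finiteness part permits cancellation later. -/
theorem hardyIntegral_balance_nonpos {α β σ p γ τ : ℝ} (hp : 1 ≤ p) (hσ : 0 < σ)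
    (hα : α ∈ Set.Ioo (-1) σ) (hβ : β ∈ Set.Ioo (-1) σ) (hγ : γ = (1 + α + β - σ) / p)
    (hτ1 : τ < 1) (hγ0 : γ ≤ 0) :
    (∫⁻ t in Set.Ioo 0 τ, ENNReal.ofReal (|1 - t ^ (-γ)| ^ (p - 1)) *
        ENNReal.ofReal ((t ^ α + t ^ β) / (1 - t) ^ (1 + σ)) =
      hardyIntegral α β σ p γ τ + ∫⁻ t in Set.Ioo 0 τ, ENNReal.ofReal (|1 - t ^ γ| ^ (p - 1)) *
        ENNReal.ofReal ((t ^ (-α) + t ^ (-β)) * t ^ (σ - 1) / (1 - t) ^ (1 + σ))) ∧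
    ∫⁻ t in Set.Ioo 0 τ, ENNReal.ofReal (|1 - t ^ γ| ^ (p - 1)) *
        ENNReal.ofReal ((t ^ (-α) + t ^ (-β)) * t ^ (σ - 1) / (1 - t) ^ (1 + σ)) < ∞ := by
  have hp0 : 0 < p := by linarith
  constructor
  · rw [hardyIntegral, ← lintegral_add_left (by fun_prop)]
    refine setLIntegral_congr_fun measurableSet_Ioo fun t ht => ?_
    have h0 : 0 < t := ht.1
    have h1 : 0 < 1 - t := by linarith [ht.2]
    rw [← ENNReal.ofReal_mul (by positivity), ← ENNReal.ofReal_mul (by positivity),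
      ← ENNReal.ofReal_add (by positivity) (by positivity), mul_div_assoc', mul_div_assoc',
      dual_weight_identity hp0 hγ h0, abs_rpow_eq_abs_rpow_sub_one_mul hp0 (1 - t ^ (-γ))]
    congr 1
    have h2 : t ^ (-γ) ≤ 1 := Real.rpow_le_one h0.le (by linarith) (by linarith)
    have h3 : |1 - t ^ (-γ)| = 1 - t ^ (-γ) := abs_of_nonneg (by linarith)
    generalize |1 - t ^ (-γ)| ^ (p - 1) = Z
    rw [h3]
    field_simp
    ring
  · refine lt_of_eq_of_lt ?_ (truncated_integral_lt_top hp hσ hα hβ hγ hτ1)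
    refine setLIntegral_congr_fun measurableSet_Ioo fun t ht => ?_
    have h0 : 0 < t := ht.1
    have h1 : 0 < 1 - t := by linarith [ht.2]
    have h2 : t ^ (-γ) ≤ 1 := Real.rpow_le_one h0.le (by linarith) (by linarith)
    rw [← ENNReal.ofReal_mul (by positivity), mul_div_assoc', dual_weight_identity hp0 hγ h0,
      min_eq_right h2]
    congr 2; ring

theorem hardyIntegral_balance_nonneg {α β σ p γ τ : ℝ} (hp : 1 ≤ p) (hσ : 0 < σ)
    (hα : α ∈ Set.Ioo (-1) σ) (hβ : β ∈ Set.Ioo (-1) σ) (hγ : γ = (1 + α + β - σ) / p)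
    (hτ1 : τ < 1) (hγ0 : 0 ≤ γ) :
    (∫⁻ t in Set.Ioo 0 τ, ENNReal.ofReal (|1 - t ^ γ| ^ (p - 1)) *
        ENNReal.ofReal ((t ^ (-α) + t ^ (-β)) * t ^ (σ - 1) / (1 - t) ^ (1 + σ)) =
      hardyIntegral α β σ p γ τ + ∫⁻ t in Set.Ioo 0 τ, ENNReal.ofReal (|1 - t ^ (-γ)| ^ (p - 1)) *
        ENNReal.ofReal ((t ^ α + t ^ β) / (1 - t) ^ (1 + σ))) ∧
    ∫⁻ t in Set.Ioo 0 τ, ENNReal.ofReal (|1 - t ^ (-γ)| ^ (p - 1)) *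
        ENNReal.ofReal ((t ^ α + t ^ β) / (1 - t) ^ (1 + σ)) < ∞ := by
  have hp0 : 0 < p := by linarith
  constructor
  · rw [hardyIntegral, ← lintegral_add_left (by fun_prop)]
    refine setLIntegral_congr_fun measurableSet_Ioo fun t ht => ?_
    have h0 : 0 < t := ht.1
    have h1 : 0 < 1 - t := by linarith [ht.2]
    rw [← ENNReal.ofReal_mul (by positivity), ← ENNReal.ofReal_mul (by positivity),
      ← ENNReal.ofReal_add (by positivity) (by positivity), mul_div_assoc', mul_div_assoc',
      dual_weight_identity hp0 hγ h0, abs_rpow_eq_abs_rpow_sub_one_mul hp0 (1 - t ^ (-γ))]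
    congr 1
    have h2 : 1 ≤ t ^ (-γ) :=
      Real.one_le_rpow_of_pos_of_le_one_of_nonpos h0 (by linarith) (by linarith)
    have h3 : |1 - t ^ (-γ)| = t ^ (-γ) - 1 := by rw [abs_of_nonpos (by linarith)]; ring
    generalize |1 - t ^ (-γ)| ^ (p - 1) = Z
    rw [h3]
    field_simp
    ring
  · refine lt_of_eq_of_lt ?_ (truncated_integral_lt_top hp hσ hα hβ hγ hτ1)
    refine setLIntegral_congr_fun measurableSet_Ioo fun t ht => ?_
    have h0 : 0 < t := ht.1
    have h1 : 0 < 1 - t := by linarith [ht.2]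
    have h2 : 1 ≤ t ^ (-γ) :=
      Real.one_le_rpow_of_pos_of_le_one_of_nonpos h0 (by linarith) (by linarith)
    rw [← ENNReal.ofReal_mul (by positivity), mul_div_assoc', min_eq_left h2]
    congr 2; ring

/-- Integrate the pointwise inequality over the truncated pairs: the terms in `|u x| ^ p` and `|u y|
^ p` combine, through the balance identities, into the truncated Hardy term. -/
theorem groundState_truncated (n : ℕ) {s p α β γ τ : ℝ} (hp : 2 ≤ p) (hσ : 0 < s * p)
    (hα : α ∈ Set.Ioo (-1) (s * p)) (hβ : β ∈ Set.Ioo (-1) (s * p))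
    (hγ : γ = (1 + α + β - s * p) / p) (hτ : 0 < τ) (hτ1 : τ < 1)
    {u : EuclideanSpace ℝ (Fin (n + 1)) → ℝ} (hu : Measurable u)
    (hfin : hardyTerm n s p α β u < ∞) :
    sliceConst (n + 1) (s * p) * hardyTerm n s p α β u * hardyIntegral α β (s * p) p γ τ +
      ENNReal.ofReal ((2 ^ (1 - p)) ^ 2) * ∫⁻ q in belowPairs n τ,
        ENNReal.ofReal ((q.1 (Fin.last n) * q.2 (Fin.last n)) ^ (-(γ * p / 2)) *
          |u q.1 * q.1 (Fin.last n) ^ γ - u q.2 * q.2 (Fin.last n) ^ γ| ^ p) *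
          ENNReal.ofReal (symKernel n α β (s * p) q.1 q.2) ≤
      ∫⁻ q in belowPairs n τ, ENNReal.ofReal (|u q.1 - u q.2| ^ p) *
          ENNReal.ofReal (symKernel n α β (s * p) q.1 q.2) := by
  have hK := measurable_symKernel n α β (s * p)
  have hc : sliceConst (n + 1) (s * p) < ∞ := ENNReal.ofReal_lt_top
  have N1 := lintegral_belowPairs_fst n (α := α) (β := β) hσ hτ1.le hu
    (φ := fun t => |1 - t ^ (-γ)| ^ (p - 1)) (by fun_prop)
  have N2 := lintegral_belowPairs_snd n (α := α) (β := β) hσ hτ hτ1.le hu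
    (φ := fun t => |1 - t ^ γ| ^ (p - 1)) (by fun_prop)
  simp only at N1 N2
  rw [← lintegral_const_mul _ (by fun_prop)]
  have mul_add₃ : ∀ (a b c : ℝ), 0 ≤ a → ENNReal.ofReal a * (ENNReal.ofReal b * ENNReal.ofReal c) =
      ENNReal.ofReal (a * b) * ENNReal.ofReal c := by
    intro a b c ha; rw [← mul_assoc, ENNReal.ofReal_mul ha]
  rcases le_total γ 0 with h0 | h0
  · obtain ⟨hb, hb'⟩ := hardyIntegral_balance_nonpos (by linarith) hσ hα hβ hγ hτ1 h0
    have hN2 := (ENNReal.mul_lt_top (ENNReal.mul_lt_top hc hfin) hb').ne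
    -- The negative term is added to both sides, since subtraction in `[0, ∞]` is unsafe. Its
    -- finiteness, which rests on `τ < 1`, justifies the cancellation.
    refine (ENNReal.add_le_add_iff_right hN2).1 ?_
    rw [add_right_comm, ← mul_add, ← hb, ← N1, ← N2, ← lintegral_add_left (by fun_prop),
      ← lintegral_add_left (by fun_prop)]
    refine setLIntegral_mono' (measurableSet_belowPairs n τ) fun q hq => ?_
    obtain ⟨hx, hy, hyx⟩ := hq
    have hyx' : q.2 (Fin.last n) ≤ q.1 (Fin.last n) := by nlinarith
    have key := groundState_pointwise_nonpos (U := u q.1) (V := u q.2) hp h0 hy hyx'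
    rw [mul_add₃ _ _ _ (by positivity), mul_add₃ _ _ _ (by positivity),
      mul_add₃ _ _ _ (by positivity), ← add_mul, ← add_mul,
      ← ENNReal.ofReal_add (by positivity) (by positivity),
      ← ENNReal.ofReal_add (by positivity) (by positivity)]
    gcongr
  · obtain ⟨hb, hb'⟩ := hardyIntegral_balance_nonneg (by linarith) hσ hα hβ hγ hτ1 h0
    have hN1 := (ENNReal.mul_lt_top (ENNReal.mul_lt_top hc hfin) hb').ne
    refine (ENNReal.add_le_add_iff_right hN1).1 ?_
    rw [add_right_comm, ← mul_add, ← hb, ← N1, ← N2, ← lintegral_add_left (by fun_prop),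
      ← lintegral_add_left (by fun_prop)]
    refine setLIntegral_mono' (measurableSet_belowPairs n τ) fun q hq => ?_
    obtain ⟨hx, hy, hyx⟩ := hq
    have hyx' : q.2 (Fin.last n) ≤ q.1 (Fin.last n) := by nlinarith
    have key := groundState_pointwise_nonneg (U := u q.1) (V := u q.2) hp h0 hy hyx'
    rw [mul_add₃ _ _ _ (by positivity), mul_add₃ _ _ _ (by positivity),
      mul_add₃ _ _ _ (by positivity), ← add_mul, ← add_mul,
      ← ENNReal.ofReal_add (by positivity) (by positivity),
      ← ENNReal.ofReal_add (by positivity) (by positivity)]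
    gcongr

/-! ### The remainder energy and the limit `τ → 1` -/

/-- The energy `∬_{y_d < x_d} |v(x) - v(y)|^p |x - y|^{-(d+σ)} (x_d y_d)^{(σ-1)/2}`. -/
noncomputable def balancedEnergy (n : ℕ) (σ p : ℝ) (v : EuclideanSpace ℝ (Fin (n + 1)) → ℝ) :
    ℝ≥0∞ :=
  ∫⁻ q in belowPairs n 1, ENNReal.ofReal (|v q.1 - v q.2| ^ p *
    ‖q.1 - q.2‖ ^ (-(((n + 1 : ℕ) : ℝ) + σ)) *
      (q.1 (Fin.last n) * q.2 (Fin.last n)) ^ ((σ - 1) / 2))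

/-- Reflecting the pairs with `x_d < y_d` onto those with `y_d < x_d` symmetrizes the weight. Pairs
of equal height are discarded, since only an inequality is needed. -/
theorem lintegral_belowPairs_le_weightedEnergy (n : ℕ) {s p α β : ℝ}
    {u : EuclideanSpace ℝ (Fin (n + 1)) → ℝ} (hu : Measurable u) :
    ∫⁻ q in belowPairs n 1, ENNReal.ofReal (|u q.1 - u q.2| ^ p) *
        ENNReal.ofReal (symKernel n α β (s * p) q.1 q.2) ≤ weightedEnergy n s p α β u := by
  set F : EuclideanSpace ℝ (Fin (n + 1)) × EuclideanSpace ℝ (Fin (n + 1)) → ℝ≥0∞ := fun q =>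
    ENNReal.ofReal (|u q.1 - u q.2| ^ p / ‖q.1 - q.2‖ ^ (((n + 1 : ℕ) : ℝ) + s * p) *
      q.1 (Fin.last n) ^ α * q.2 (Fin.last n) ^ β) with hF
  have hFm : Measurable F := by fun_prop
  have hB := measurableSet_belowPairs n 1
  have hE : weightedEnergy n s p α β u =
      ∫⁻ q in halfSpace n ×ˢ halfSpace n, F q ∂(volume.prod volume) := by
    rw [← Measure.prod_restrict, lintegral_prod _ hFm.aemeasurable]
    rfl
  rw [hE]
  have hB' : MeasurableSet (Prod.swap ⁻¹' belowPairs n 1) := measurable_swap hB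
  have hdisj : Disjoint (belowPairs n 1) (Prod.swap ⁻¹' belowPairs n 1) := by
    rw [Set.disjoint_left]
    rintro q ⟨_, _, h1⟩ ⟨_, _, h2⟩
    simp only [Prod.fst_swap, Prod.snd_swap, one_mul] at h1 h2
    exact lt_asymm h1 h2
  have hsub : belowPairs n 1 ∪ Prod.swap ⁻¹' belowPairs n 1 ⊆ halfSpace n ×ˢ halfSpace n := by
    rintro q (⟨h1, h2, _⟩ | ⟨h1, h2, _⟩)
    · exact ⟨h1, h2⟩
    · exact ⟨h2, h1⟩
  have hswap : ∫⁻ q in Prod.swap ⁻¹' belowPairs n 1, F q ∂(volume.prod volume) =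
      ∫⁻ q in belowPairs n 1, F q.swap ∂(volume.prod volume) := by
    have := (Measure.measurePreserving_swap (μ := (volume : Measure (EuclideanSpace ℝ (Fin (n + 1)))))
      (ν := (volume : Measure (EuclideanSpace ℝ (Fin (n + 1)))))).setLIntegral_comp_preimage hB
      (hFm.comp measurable_swap)
    simpa using this
  refine le_trans (le_of_eq ?_) (lintegral_mono_set hsub)
  rw [lintegral_union hB' hdisj, hswap, ← lintegral_add_left hFm, Measure.volume_eq_prod]
  refine setLIntegral_congr_fun hB fun q hq => ?_
  obtain ⟨hx, hy, -⟩ := hq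
  simp only [hF, Prod.fst_swap, Prod.snd_swap]
  rw [← ENNReal.ofReal_add (by positivity) (by positivity), ← ENNReal.ofReal_mul (by positivity),
    norm_sub_rev q.2, abs_sub_comm (u q.2), symKernel, Real.rpow_neg (norm_nonneg _)]
  congr 1
  ring

/-- AM-GM for the two weight products; the bound sees only `α + β`. -/
theorem two_mul_rpow_le_symKernel (n : ℕ) {α β σ : ℝ} {x y : EuclideanSpace ℝ (Fin (n + 1))}
    (hx : 0 < x (Fin.last n)) (hy : 0 < y (Fin.last n)) :
    2 * ((x (Fin.last n) * y (Fin.last n)) ^ ((α + β) / 2) *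
      ‖x - y‖ ^ (-(((n + 1 : ℕ) : ℝ) + σ))) ≤ symKernel n α β σ x y := by
  rw [symKernel, ← mul_assoc]
  refine mul_le_mul_of_nonneg_right ?_ (by positivity)
  set X := x (Fin.last n)
  set Y := y (Fin.last n)
  have hsq : ∀ z c : ℝ, 0 < z → z ^ c = (z ^ (c / 2)) ^ 2 := by
    intro z c hz
    rw [← Real.rpow_natCast, ← Real.rpow_mul hz.le]; congr 1; push_cast; ring
  have e : (X * Y) ^ ((α + β) / 2) = X ^ (α / 2) * Y ^ (β / 2) * (X ^ (β / 2) * Y ^ (α / 2)) := by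
    rw [Real.mul_rpow hx.le hy.le, add_div, Real.rpow_add hx, Real.rpow_add hy]; ring
  rw [e, hsq X α hx, hsq X β hx, hsq Y α hy, hsq Y β hy]
  nlinarith [sq_nonneg (X ^ (α / 2) * Y ^ (β / 2) - X ^ (β / 2) * Y ^ (α / 2))]

/-- The exponents add up to `-(γ * p / 2) + (α + β) / 2 = (s * p - 1) / 2`, which frees the
remainder from `α` and `β`. -/
theorem two_mul_balancedEnergy_le (n : ℕ) {s p α β γ : ℝ} (hp : 0 < p)
    (hγ : γ = (1 + α + β - s * p) / p) (u : EuclideanSpace ℝ (Fin (n + 1)) → ℝ) (hu : Measurable u) :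
    2 * balancedEnergy n (s * p) p (fun x => u x * x (Fin.last n) ^ γ) ≤
      ∫⁻ q in belowPairs n 1,
        ENNReal.ofReal ((q.1 (Fin.last n) * q.2 (Fin.last n)) ^ (-(γ * p / 2)) *
          |u q.1 * q.1 (Fin.last n) ^ γ - u q.2 * q.2 (Fin.last n) ^ γ| ^ p) *
          ENNReal.ofReal (symKernel n α β (s * p) q.1 q.2) := by
  rw [balancedEnergy, ← lintegral_const_mul _ (by fun_prop)]
  refine setLIntegral_mono' (measurableSet_belowPairs n 1) fun q hq => ?_
  obtain ⟨hx, hy, -⟩ := hq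
  have h2 : ∀ z : ℝ, 2 * ENNReal.ofReal z = ENNReal.ofReal (2 * z) := fun z => by
    rw [ENNReal.ofReal_mul (by norm_num), ENNReal.ofReal_ofNat]
  rw [h2, ← ENNReal.ofReal_mul (by positivity)]
  apply ENNReal.ofReal_le_ofReal
  have key := two_mul_rpow_le_symKernel n (α := α) (β := β) (σ := s * p) hx hy
  refine le_trans (le_of_eq ?_) (mul_le_mul_of_nonneg_left key (by positivity))
  have e : (q.1 (Fin.last n) * q.2 (Fin.last n)) ^ ((s * p - 1) / 2) =
      (q.1 (Fin.last n) * q.2 (Fin.last n)) ^ (-(γ * p / 2)) *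
        (q.1 (Fin.last n) * q.2 (Fin.last n)) ^ ((α + β) / 2) := by
    rw [← Real.rpow_add (by positivity)]; congr 1; rw [hγ]; field_simp; ring
  rw [e]; ring

/-- The ground state representation with remainder: the Hardy deficit controls the energy of
`u x_d^γ`. -/
theorem hardy_add_balancedEnergy_le (n : ℕ) {s p α β γ : ℝ} (hp : 2 ≤ p) (hσ : 0 < s * p)
    (hα : α ∈ Set.Ioo (-1) (s * p)) (hβ : β ∈ Set.Ioo (-1) (s * p))
    (hγ : γ = (1 + α + β - s * p) / p)
    {u : EuclideanSpace ℝ (Fin (n + 1)) → ℝ} (hu : Measurable u)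
    (hfin : hardyTerm n s p α β u < ∞) :
    hardyConst (n + 1) s p α β * hardyTerm n s p α β u +
      ENNReal.ofReal ((2 ^ (1 - p)) ^ 2) *
        (2 * balancedEnergy n (s * p) p (fun x => u x * x (Fin.last n) ^ γ)) ≤
      weightedEnergy n s p α β u := by
  refine le_trans (add_le_add_right (mul_le_mul_right
    (two_mul_balancedEnergy_le n (by linarith) hγ u hu) _) _) ?_
  refine le_trans ?_ (lintegral_belowPairs_le_weightedEnergy n hu)
  -- Increases to `1`; the shift by `2` makes already `τ 0` positive.
  set τ : ℕ → ℝ := fun m => 1 - 1 / ((m : ℝ) + 2) with hτ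
  have hτ0 : ∀ m, 0 < τ m := by
    intro m
    simp only [hτ, sub_pos]
    rw [div_lt_one (by positivity)]
    have : (0 : ℝ) ≤ m := Nat.cast_nonneg m
    linarith
  have hτ1 : ∀ m, τ m < 1 := by
    intro m
    simp only [hτ]
    have : (0 : ℝ) < 1 / ((m : ℝ) + 2) := by positivity
    linarith
  have hτm : Monotone τ := by
    intro a b hab
    simp only [hτ]
    have : (a : ℝ) ≤ b := Nat.cast_le.2 hab
    gcongr
  have hτlim : ∀ t < 1, ∃ m, t < τ m := by
    intro t ht
    obtain ⟨m, hm⟩ := exists_nat_one_div_lt (sub_pos.2 ht)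
    refine ⟨m, ?_⟩
    simp only [hτ]
    have : 1 / ((m : ℝ) + 2) ≤ 1 / ((m : ℝ) + 1) := by gcongr; linarith
    linarith
  have hImono : Monotone fun m => Set.Ioo 0 (τ m) :=
    fun a b hab => Set.Ioo_subset_Ioo_right (hτm hab)
  have hBmono : Monotone fun m => belowPairs n (τ m) := by
    rintro a b hab q ⟨h1, h2, h3⟩
    exact ⟨h1, h2, h3.trans_le (mul_le_mul_of_nonneg_right (hτm hab) h1.le)⟩
  have hI : Set.Ioo (0 : ℝ) 1 = ⋃ m, Set.Ioo 0 (τ m) := by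
    ext t
    simp only [Set.mem_iUnion, Set.mem_Ioo]
    constructor
    · rintro ⟨h0, h1⟩
      obtain ⟨m, hm⟩ := hτlim t h1
      exact ⟨m, h0, hm⟩
    · rintro ⟨m, h0, h1⟩
      exact ⟨h0, h1.trans (hτ1 m)⟩
  have hBsub : ∀ m, belowPairs n (τ m) ⊆ belowPairs n 1 := by
    rintro m q ⟨h1, h2, h3⟩
    exact ⟨h1, h2, h3.trans_le (mul_le_mul_of_nonneg_right (hτ1 m).le h1.le)⟩
  have hB : belowPairs n 1 = ⋃ m, belowPairs n (τ m) := by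
    refine Set.Subset.antisymm ?_ (Set.iUnion_subset hBsub)
    rintro q ⟨h1, h2, h3⟩
    obtain ⟨m, hm⟩ := hτlim (q.2 (Fin.last n) / q.1 (Fin.last n))
      (by rw [div_lt_one h1]; simpa using h3)
    exact Set.mem_iUnion.2 ⟨m, h1, h2, by rwa [div_lt_iff₀ h1] at hm⟩
  have hD : hardyConst (n + 1) s p α β = sliceConst (n + 1) (s * p) *
      ⨆ m, hardyIntegral α β (s * p) p γ (τ m) := by
    simp only [hardyConst, sliceConst, hardyIntegral, ← hγ]
    rw [hI, setLIntegral_iUnion_of_directed _ hImono.directed_le]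
  rw [hD]
  conv_lhs => rw [hB]
  rw [setLIntegral_iUnion_of_directed _ hBmono.directed_le, mul_right_comm, ENNReal.mul_iSup,
    ENNReal.mul_iSup, ENNReal.iSup_add_iSup_of_monotone]
  · refine iSup_le fun m => ?_
    exact (groundState_truncated n hp hσ hα hβ hγ (hτ0 m) (hτ1 m) hu hfin).trans
      (lintegral_mono_set (hBsub m))
  · intro a b hab
    exact mul_le_mul_right (lintegral_mono_set (hImono hab)) _
  · intro a b hab
    exact mul_le_mul_right (lintegral_mono_set (hBmono hab)) _

/-! ### Averages over balls above a point -/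

/-- The difference of averages is the mean of `v x - v y` for the product of the normalized
measures; Jensen does the rest. -/
theorem edist_setAverage_rpow_le {E : Type*} [MeasurableSpace E] {μ : Measure E} [SFinite μ]
    {A B : Set E} (hA0 : μ A ≠ 0) (hA : μ A ≠ ∞) (hB0 : μ B ≠ 0) (hB : μ B ≠ ∞) {p : ℝ}
    (hp : 1 ≤ p) {v : E → ℝ} (hvm : Measurable v) (hvA : IntegrableOn v A μ)
    (hvB : IntegrableOn v B μ) :
    edist (⨍ x in A, v x ∂μ) (⨍ x in B, v x ∂μ) ^ p ≤
      (μ A * μ B)⁻¹ * ∫⁻ q in A ×ˢ B, ENNReal.ofReal (|v q.1 - v q.2| ^ p) ∂(μ.prod μ) := by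
  have hp0 : 0 < p := by linarith
  have hAf : IsFiniteMeasure (μ.restrict A) := ⟨by rw [Measure.restrict_apply_univ]; exact hA.lt_top⟩
  have hBf : IsFiniteMeasure (μ.restrict B) := ⟨by rw [Measure.restrict_apply_univ]; exact hB.lt_top⟩
  have hAn : NeZero (μ.restrict A) := ⟨by rw [Ne, Measure.restrict_eq_zero]; exact hA0⟩
  have hBn : NeZero (μ.restrict B) := ⟨by rw [Ne, Measure.restrict_eq_zero]; exact hB0⟩
  set P := (μ.restrict A Set.univ)⁻¹ • μ.restrict A with hP
  set Q := (μ.restrict B Set.univ)⁻¹ • μ.restrict B with hQ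
  have hPp : IsProbabilityMeasure P := by rw [hP]; infer_instance
  have hQp : IsProbabilityMeasure Q := by rw [hQ]; infer_instance
  have hvP : Integrable v P := hvA.to_average
  have hvQ : Integrable v Q := hvB.to_average
  have e1 : (⨍ x in A, v x ∂μ) - (⨍ x in B, v x ∂μ) = ∫ q, (v q.1 - v q.2) ∂(P.prod Q) := by
    rw [integral_sub (hvP.comp_fst Q) (hvQ.comp_snd P), integral_fun_fst, integral_fun_snd]
    simp only [probReal_univ, one_smul]
    rfl
  have hm : Measurable fun q : E × E => v q.1 - v q.2 := by fun_prop
  have e2 : edist (⨍ x in A, v x ∂μ) (⨍ x in B, v x ∂μ) ≤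
      (∫⁻ q, ‖v q.1 - v q.2‖ₑ ^ p ∂(P.prod Q)) ^ (1 / p) := by
    rw [edist_eq_enorm_sub, e1]
    refine (enorm_integral_le_lintegral_enorm _).trans ?_
    have h := eLpNorm_le_eLpNorm_of_exponent_le (p := 1) (q := ENNReal.ofReal p) (μ := P.prod Q)
      (by simpa using hp) hm.aestronglyMeasurable
    rw [eLpNorm_one_eq_lintegral_enorm, eLpNorm_eq_lintegral_rpow_enorm_toReal (by simpa using hp0)
      ENNReal.ofReal_ne_top, ENNReal.toReal_ofReal hp0.le] at h
    exact h
  refine (ENNReal.rpow_le_rpow e2 hp0.le).trans ?_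
  rw [← ENNReal.rpow_mul, one_div_mul_cancel hp0.ne', ENNReal.rpow_one]
  have e3 : P.prod Q = (μ A * μ B)⁻¹ • ((μ.prod μ).restrict (A ×ˢ B)) := by
    rw [hP, hQ, Measure.prod_smul_left, Measure.prod_smul_right, smul_smul, Measure.prod_restrict,
      Measure.restrict_apply_univ, Measure.restrict_apply_univ,
      ENNReal.mul_inv (Or.inl hA0) (Or.inl hA)]
  rw [e3, lintegral_smul_measure, smul_eq_mul]
  gcongr with q
  rw [Real.enorm_eq_ofReal_abs, ENNReal.ofReal_rpow_of_nonneg (abs_nonneg _) hp0.le]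

theorem rpow_le_of_comparable {K r R c : ℝ} (hK : 1 ≤ K) (hR : 0 < R) (hr : 0 < r)
    (h1 : R ≤ K * r) (h2 : r ≤ K * R) : r ^ c ≤ K ^ |c| * R ^ c := by
  have hK0 : 0 < K := by linarith
  rcases le_total 0 c with hc | hc
  · rw [abs_of_nonneg hc, ← Real.mul_rpow hK0.le hR.le]
    exact Real.rpow_le_rpow hr.le h2 hc
  · have : R / K ≤ r := by rw [div_le_iff₀ hK0]; linarith
    rw [abs_of_nonpos hc, Real.rpow_neg hK0.le, ← div_eq_inv_mul, ← Real.div_rpow hR.le hK0.le]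
    exact Real.rpow_le_rpow_of_nonpos (by positivity) this hc

/-- The ball of radius `ρ / 6` around the point at distance `ρ` vertically above `x`. -/
noncomputable def upperBall (n : ℕ) (x : EuclideanSpace ℝ (Fin (n + 1))) (ρ : ℝ) :
    Set (EuclideanSpace ℝ (Fin (n + 1))) :=
  Metric.ball (x + ρ • EuclideanSpace.single (Fin.last n) 1) (ρ / 6)

theorem norm_single_last (n : ℕ) :
    ‖(EuclideanSpace.single (Fin.last n) 1 : EuclideanSpace ℝ (Fin (n + 1)))‖ = 1 := by simp

theorem upperBall_last {n : ℕ} {x y : EuclideanSpace ℝ (Fin (n + 1))} {ρ : ℝ}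
    (hy : y ∈ upperBall n x ρ) :
    |y (Fin.last n) - (x (Fin.last n) + ρ)| < ρ / 6 := by
  rw [upperBall, Metric.mem_ball, dist_eq_norm] at hy
  have := (PiLp.norm_apply_le (y - (x + ρ • EuclideanSpace.single (Fin.last n) 1))
    (Fin.last n)).trans_lt hy
  simpa using this

theorem upperBall_norm_sub {n : ℕ} {x y : EuclideanSpace ℝ (Fin (n + 1))} {ρ : ℝ} (hρ : 0 < ρ)
    (hy : y ∈ upperBall n x ρ) : ‖x - y‖ < 7 / 6 * ρ := by
  rw [upperBall, Metric.mem_ball, dist_eq_norm] at hy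
  have e : x - y = -(y - (x + ρ • EuclideanSpace.single (Fin.last n) 1)) -
    ρ • EuclideanSpace.single (Fin.last n) 1 := by abel
  rw [e]
  refine (norm_sub_le _ _).trans_lt ?_
  rw [norm_neg, norm_smul, norm_single_last, Real.norm_of_nonneg hρ.le]
  linarith

/-- The centres are `ρ` apart and the radii `ρ / 6` and `ρ / 3` add up to `ρ / 2`, so the balls stay
apart, one entirely above the other. -/
theorem upperBall_pair_norm {n : ℕ} {x y z : EuclideanSpace ℝ (Fin (n + 1))} {ρ : ℝ} (hρ : 0 < ρ)
    (hy : y ∈ upperBall n x ρ) (hz : z ∈ upperBall n x (2 * ρ)) :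
    ρ / 2 < ‖z - y‖ ∧ ‖z - y‖ < 3 / 2 * ρ := by
  constructor
  · have h1 := abs_lt.1 (upperBall_last hy)
    have h2 := abs_lt.1 (upperBall_last hz)
    have h3 := (le_abs_self _).trans (PiLp.norm_apply_le (z - y) (Fin.last n))
    simp only [PiLp.sub_apply] at h3
    linarith [h1.1, h1.2, h2.1, h2.2]
  · rw [upperBall, Metric.mem_ball, dist_eq_norm] at hy hz
    have e : z - y = (z - (x + (2 * ρ) • EuclideanSpace.single (Fin.last n) 1)) -
      (y - (x + ρ • EuclideanSpace.single (Fin.last n) 1)) +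
        ρ • EuclideanSpace.single (Fin.last n) 1 := by
      rw [two_mul, add_smul]; abel
    rw [e]
    refine (norm_add_le _ _).trans_lt ?_
    have := norm_sub_le (z - (x + (2 * ρ) • EuclideanSpace.single (Fin.last n) 1))
      (y - (x + ρ • EuclideanSpace.single (Fin.last n) (1 : ℝ)))
    rw [norm_smul, norm_single_last, Real.norm_of_nonneg hρ.le]
    linarith

theorem volume_upperBall (n : ℕ) (x : EuclideanSpace ℝ (Fin (n + 1))) {ρ : ℝ} (hρ : 0 < ρ) :
    volume (upperBall n x ρ) = ENNReal.ofReal ((ρ / 6) ^ (n + 1) *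
      (volume (Metric.ball (0 : EuclideanSpace ℝ (Fin (n + 1))) 1)).toReal) := by
  rw [upperBall, Measure.addHaar_ball _ _ (by positivity), finrank_euclideanSpace_fin,
    ENNReal.ofReal_mul (by positivity), ENNReal.ofReal_toReal measure_ball_lt_top.ne]

theorem volume_ball_one_toReal_pos (n : ℕ) :
    0 < (volume (Metric.ball (0 : EuclideanSpace ℝ (Fin (n + 1))) 1)).toReal :=
  ENNReal.toReal_pos (Metric.measure_ball_pos _ _ one_pos).ne' measure_ball_lt_top.ne

/-- The integrand of `balancedEnergy`. -/
noncomputable def balancedDensity (n : ℕ) (σ p : ℝ) (v : EuclideanSpace ℝ (Fin (n + 1)) → ℝ)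
    (q : EuclideanSpace ℝ (Fin (n + 1)) × EuclideanSpace ℝ (Fin (n + 1))) : ℝ≥0∞ :=
  ENNReal.ofReal (|v q.1 - v q.2| ^ p * ‖q.1 - q.2‖ ^ (-(((n + 1 : ℕ) : ℝ) + σ)) *
    (q.1 (Fin.last n) * q.2 (Fin.last n)) ^ ((σ - 1) / 2))

theorem balancedEnergy_eq (n : ℕ) (σ p : ℝ) (v : EuclideanSpace ℝ (Fin (n + 1)) → ℝ) :
    balancedEnergy n σ p v = ∫⁻ q in belowPairs n 1, balancedDensity n σ p v q := rfl

theorem measurable_balancedDensity (n : ℕ) (σ p : ℝ) {v : EuclideanSpace ℝ (Fin (n + 1)) → ℝ}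
    (hv : Measurable v) : Measurable (balancedDensity n σ p v) := by
  unfold balancedDensity; fun_prop

/-- The energy between two consecutive balls above `x`. -/
noncomputable def stepEnergy (n : ℕ) (σ p : ℝ) (v : EuclideanSpace ℝ (Fin (n + 1)) → ℝ)
    (x : EuclideanSpace ℝ (Fin (n + 1))) (ρ : ℝ) : ℝ≥0∞ :=
  ∫⁻ q in upperBall n x (2 * ρ) ×ˢ upperBall n x ρ, balancedDensity n σ p v q

theorem upperBall_prod_subset_belowPairs {n : ℕ} {x : EuclideanSpace ℝ (Fin (n + 1))} {ρ : ℝ}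
    (hx : 0 < x (Fin.last n)) (hρ : 0 < ρ) :
    upperBall n x (2 * ρ) ×ˢ upperBall n x ρ ⊆ belowPairs n 1 := by
  rintro q ⟨hz, hy⟩
  have h1 := abs_lt.1 (upperBall_last hy)
  have h2 := abs_lt.1 (upperBall_last hz)
  refine ⟨?_, ?_, ?_⟩ <;> linarith [h1.1, h1.2, h2.1, h2.2]

theorem stepEnergy_le (n : ℕ) (σ p : ℝ) (v : EuclideanSpace ℝ (Fin (n + 1)) → ℝ)
    {x : EuclideanSpace ℝ (Fin (n + 1))} {ρ : ℝ} (hx : 0 < x (Fin.last n)) (hρ : 0 < ρ) :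
    stepEnergy n σ p v x ρ ≤ balancedEnergy n σ p v :=
  lintegral_mono_set (upperBall_prod_subset_belowPairs hx hρ)

/-- The average of `v` over the ball above `x`. -/
noncomputable def upperAvg (n : ℕ) (v : EuclideanSpace ℝ (Fin (n + 1)) → ℝ)
    (x : EuclideanSpace ℝ (Fin (n + 1))) (ρ : ℝ) : ℝ :=
  ⨍ y in upperBall n x ρ, v y

/-- On such a pair of balls the kernel is comparable to a constant: distances are of size `ρ` and
both heights of size `x_d + ρ`. -/
theorem ofReal_diff_rpow_le_density {n : ℕ} {σ p : ℝ} (hσ : 0 < σ)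
    (v : EuclideanSpace ℝ (Fin (n + 1)) → ℝ) {x y z : EuclideanSpace ℝ (Fin (n + 1))} {ρ : ℝ}
    (hx : 0 < x (Fin.last n)) (hρ : 0 < ρ) (hy : y ∈ upperBall n x ρ)
    (hz : z ∈ upperBall n x (2 * ρ)) :
    ENNReal.ofReal (|v z - v y| ^ p) ≤
      ENNReal.ofReal ((3 / 2) ^ (((n + 1 : ℕ) : ℝ) + σ) * 9 ^ |(1 - σ) / 2| *
        (ρ ^ (((n + 1 : ℕ) : ℝ) + σ) * (x (Fin.last n) + ρ) ^ (1 - σ))) *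
        balancedDensity n σ p v (z, y) := by
  have h1 := abs_lt.1 (upperBall_last hy)
  have h2 := abs_lt.1 (upperBall_last hz)
  obtain ⟨h3, h4⟩ := upperBall_pair_norm hρ hy hz
  set h := x (Fin.last n)
  set Y := y (Fin.last n)
  set Z := z (Fin.last n)
  have hR : 0 < h + ρ := by positivity
  have hY1 : h + ρ ≤ 3 * Y := by linarith [h1.1]
  have hY2 : Y ≤ 3 * (h + ρ) := by linarith [h1.2]
  have hZ1 : h + ρ ≤ 3 * Z := by linarith [h2.1]
  have hZ2 : Z ≤ 3 * (h + ρ) := by linarith [h2.2]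
  have hY : 0 < Y := by linarith
  have hZ : 0 < Z := by linarith
  have hw : (Z * Y) ^ ((1 - σ) / 2) ≤ 9 ^ |(1 - σ) / 2| * (h + ρ) ^ (1 - σ) := by
    have := rpow_le_of_comparable (K := 9) (r := Z * Y) (R := (h + ρ) ^ 2) (c := (1 - σ) / 2)
      (by norm_num) (by positivity) (by positivity) (by nlinarith) (by nlinarith)
    rwa [← Real.rpow_natCast (h + ρ), ← Real.rpow_mul hR.le,
      show ((2 : ℕ) : ℝ) * ((1 - σ) / 2) = 1 - σ by push_cast; ring] at this
  have hn0 : 0 < ‖z - y‖ := by linarith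
  have hk : ‖z - y‖ ^ (((n + 1 : ℕ) : ℝ) + σ) ≤
      (3 / 2) ^ (((n + 1 : ℕ) : ℝ) + σ) * ρ ^ (((n + 1 : ℕ) : ℝ) + σ) := by
    rw [← Real.mul_rpow (by norm_num) hρ.le]
    exact Real.rpow_le_rpow hn0.le h4.le (by positivity)
  rw [balancedDensity, ← ENNReal.ofReal_mul (by positivity)]
  apply ENNReal.ofReal_le_ofReal
  have e1 : (Z * Y) ^ ((1 - σ) / 2) * (Z * Y) ^ ((σ - 1) / 2) = 1 := by
    rw [← Real.rpow_add (by positivity), show (1 - σ) / 2 + (σ - 1) / 2 = 0 by ring, Real.rpow_zero]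
  have e2 : ‖z - y‖ ^ (((n + 1 : ℕ) : ℝ) + σ) * ‖z - y‖ ^ (-(((n + 1 : ℕ) : ℝ) + σ)) = 1 := by
    rw [← Real.rpow_add hn0, add_neg_cancel, Real.rpow_zero]
  have hD : 0 ≤ |v z - v y| ^ p * ‖z - y‖ ^ (-(((n + 1 : ℕ) : ℝ) + σ)) * (Z * Y) ^ ((σ - 1) / 2) := by
    positivity
  calc |v z - v y| ^ p = (‖z - y‖ ^ (((n + 1 : ℕ) : ℝ) + σ) * (Z * Y) ^ ((1 - σ) / 2)) *
        (|v z - v y| ^ p * ‖z - y‖ ^ (-(((n + 1 : ℕ) : ℝ) + σ)) * (Z * Y) ^ ((σ - 1) / 2)) := by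
        linear_combination (-(|v z - v y| ^ p)) * e1 * (‖z - y‖ ^ (((n + 1 : ℕ) : ℝ) + σ) *
          ‖z - y‖ ^ (-(((n + 1 : ℕ) : ℝ) + σ))) - (|v z - v y| ^ p) * e2
    _ ≤ ((3 / 2) ^ (((n + 1 : ℕ) : ℝ) + σ) * ρ ^ (((n + 1 : ℕ) : ℝ) + σ) *
          (9 ^ |(1 - σ) / 2| * (h + ρ) ^ (1 - σ))) *
        (|v z - v y| ^ p * ‖z - y‖ ^ (-(((n + 1 : ℕ) : ℝ) + σ)) * (Z * Y) ^ ((σ - 1) / 2)) := by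
        gcongr
    _ = _ := by simp only [Z, Y]; ring

/-- The kernel contributes `ρ ^ (d + σ)` and the two volumes divide by a multiple of `ρ ^ (2 * d)`,
which leaves `ρ ^ (σ - d)`. -/
theorem exists_edist_upperAvg_rpow_le (n : ℕ) {σ p : ℝ} (hσ : 0 < σ) (hp : 1 ≤ p) :
    ∃ C : ℝ, 0 < C ∧ ∀ (v : EuclideanSpace ℝ (Fin (n + 1)) → ℝ), Continuous v →
      HasCompactSupport v → ∀ (x : EuclideanSpace ℝ (Fin (n + 1))) (ρ : ℝ), 0 < x (Fin.last n) →
      0 < ρ → edist (upperAvg n v x (2 * ρ)) (upperAvg n v x ρ) ^ p ≤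
        ENNReal.ofReal (C * (ρ ^ (σ - ((n + 1 : ℕ) : ℝ)) * (x (Fin.last n) + ρ) ^ (1 - σ))) *
          stepEnergy n σ p v x ρ := by
  set ω := (volume (Metric.ball (0 : EuclideanSpace ℝ (Fin (n + 1))) 1)).toReal with hω
  have hω0 : 0 < ω := volume_ball_one_toReal_pos n
  set C₁ : ℝ := (3 / 2) ^ (((n + 1 : ℕ) : ℝ) + σ) * 9 ^ |(1 - σ) / 2| with hC₁
  have hC₁0 : 0 < C₁ := by positivity
  refine ⟨C₁ * ((2 / 6) ^ (n + 1) * ω * ((1 / 6) ^ (n + 1) * ω))⁻¹, by positivity,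
    fun v hv hvc x ρ hx hρ => ?_⟩
  have hvi : Integrable v := hv.integrable_of_hasCompactSupport hvc
  have hV : ∀ r : ℝ, 0 < r → volume (upperBall n x r) ≠ 0 ∧ volume (upperBall n x r) ≠ ∞ := by
    intro r hr
    exact ⟨(Metric.measure_ball_pos _ _ (by positivity)).ne', measure_ball_lt_top.ne⟩
  have h2ρ : 0 < 2 * ρ := by positivity
  refine (edist_setAverage_rpow_le (hV _ h2ρ).1 (hV _ h2ρ).2 (hV _ hρ).1 (hV _ hρ).2 hp
    hv.measurable hvi.integrableOn hvi.integrableOn).trans ?_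
  have hm : MeasurableSet (upperBall n x (2 * ρ) ×ˢ upperBall n x ρ) :=
    measurableSet_ball.prod measurableSet_ball
  have hintegral : ∫⁻ q in upperBall n x (2 * ρ) ×ˢ upperBall n x ρ,
        ENNReal.ofReal (|v q.1 - v q.2| ^ p) ∂(volume.prod volume) ≤
      ENNReal.ofReal (C₁ * (ρ ^ (((n + 1 : ℕ) : ℝ) + σ) * (x (Fin.last n) + ρ) ^ (1 - σ))) *
        stepEnergy n σ p v x ρ := by
    rw [stepEnergy, ← lintegral_const_mul _ (measurable_balancedDensity n σ p hv.measurable),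
      Measure.volume_eq_prod]
    exact setLIntegral_mono' hm fun q hq => ofReal_diff_rpow_le_density hσ v hx hρ hq.2 hq.1
  refine (mul_le_mul_right hintegral _).trans (le_of_eq ?_)
  rw [volume_upperBall n x h2ρ, volume_upperBall n x hρ, ← ENNReal.ofReal_mul (by positivity),
    ← ENNReal.ofReal_inv_of_pos (by positivity), ← mul_assoc, ← ENNReal.ofReal_mul (by positivity)]
  congr 2
  have e : ρ ^ (((n + 1 : ℕ) : ℝ) + σ) =
      ρ ^ (σ - ((n + 1 : ℕ) : ℝ)) * (ρ ^ (n + 1) * ρ ^ (n + 1)) := by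
    rw [← Real.rpow_natCast, ← Real.rpow_add hρ, ← Real.rpow_add hρ]; congr 1; ring
  rw [e, ← hω, div_pow, mul_pow, div_pow, div_pow, div_pow, one_pow]
  field_simp

theorem tendsto_upperAvg_zero (n : ℕ) {v : EuclideanSpace ℝ (Fin (n + 1)) → ℝ} (hv : Continuous v)
    (hvc : HasCompactSupport v) (x : EuclideanSpace ℝ (Fin (n + 1))) {r : ℕ → ℝ}
    (hr0 : ∀ j, 0 < r j) (hr : Filter.Tendsto r Filter.atTop (nhds 0)) :
    Filter.Tendsto (fun j => upperAvg n v x (r j)) Filter.atTop (nhds (v x)) := by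
  have hvi : Integrable v := hv.integrable_of_hasCompactSupport hvc
  rw [Metric.tendsto_atTop']
  intro ε hε
  obtain ⟨δ, hδ, hδε⟩ := Metric.continuous_iff.1 hv x (ε / 2) (by positivity)
  have hev := (hr.const_mul (7 / 6)).eventually (gt_mem_nhds (by simpa using hδ))
  obtain ⟨N, hN⟩ := Filter.eventually_atTop.1 hev
  refine ⟨N, fun j hj => ?_⟩
  have hmem : upperAvg n v x (r j) ∈ Metric.closedBall (v x) (ε / 2) := by
    refine Convex.set_average_mem (convex_closedBall _ _) Metric.isClosed_closedBall
      (Metric.measure_ball_pos _ _ (by have := hr0 j; positivity)).ne' measure_ball_lt_top.ne ?_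
      hvi.integrableOn
    filter_upwards [ae_restrict_mem measurableSet_ball] with y hy
    refine Metric.mem_closedBall.2 (hδε y ?_).le
    rw [dist_comm, dist_eq_norm]
    exact (upperBall_norm_sub (hr0 j) hy).trans (hN j hj.le)
  exact (Metric.mem_closedBall.1 hmem).trans_lt (by linarith)

/-- The averages are eventually zero, because the balls rise above the compact support. -/
theorem tendsto_upperAvg_atTop (n : ℕ) {v : EuclideanSpace ℝ (Fin (n + 1)) → ℝ}
    (hvc : HasCompactSupport v) (x : EuclideanSpace ℝ (Fin (n + 1))) (hx : 0 < x (Fin.last n))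
    {r : ℕ → ℝ} (hr : Filter.Tendsto r Filter.atTop Filter.atTop) :
    Filter.Tendsto (fun j => upperAvg n v x (r j)) Filter.atTop (nhds 0) := by
  obtain ⟨M, hM⟩ := hvc.isCompact.isBounded.exists_norm_le
  refine tendsto_const_nhds.congr' ?_
  filter_upwards [hr.eventually_gt_atTop (2 * |M|)] with j hj
  rw [upperAvg, setAverage_eq, setIntegral_eq_zero_of_forall_eq_zero, smul_zero]
  intro y hy
  by_contra hne
  have h1 := hM y (subset_tsupport v hne)
  have h2 := (le_abs_self _).trans (PiLp.norm_apply_le y (Fin.last n))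
  have h3 := abs_lt.1 (upperBall_last hy)
  have := le_abs_self M
  have := abs_nonneg M
  linarith [h3.1]

/-- Telescope from the average at scale `x_d` down to `v x` and up to `0`. The exponent `j + 1` in
the first sum starts the descent at the step from `x_d` to `x_d / 2`. -/
theorem enorm_le_tsum_edist_upperAvg (n : ℕ) {v : EuclideanSpace ℝ (Fin (n + 1)) → ℝ}
    (hv : Continuous v) (hvc : HasCompactSupport v) (x : EuclideanSpace ℝ (Fin (n + 1)))
    (hx : 0 < x (Fin.last n)) :
    ENNReal.ofReal |v x| ≤
      (∑' j : ℕ, edist (upperAvg n v x (2 * (x (Fin.last n) * (1 / 2) ^ (j + 1))))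
        (upperAvg n v x (x (Fin.last n) * (1 / 2) ^ (j + 1)))) +
      ∑' k : ℕ, edist (upperAvg n v x (2 * (x (Fin.last n) * 2 ^ k)))
        (upperAvg n v x (x (Fin.last n) * 2 ^ k)) := by
  set h := x (Fin.last n)
  have h1 : Filter.Tendsto (fun j : ℕ => upperAvg n v x (h * (1 / 2) ^ j)) Filter.atTop
      (nhds (v x)) := by
    refine tendsto_upperAvg_zero n hv hvc x (fun j => by positivity) ?_
    simpa using (tendsto_pow_atTop_nhds_zero_of_lt_one (by norm_num : (0 : ℝ) ≤ 1 / 2)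
      (by norm_num)).const_mul h
  have h2 : Filter.Tendsto (fun k : ℕ => upperAvg n v x (h * 2 ^ k)) Filter.atTop (nhds 0) :=
    tendsto_upperAvg_atTop n hvc x hx
      ((tendsto_pow_atTop_atTop_of_one_lt (by norm_num : (1 : ℝ) < 2)).const_mul_atTop hx)
  have e : ENNReal.ofReal |v x| = edist (v x) 0 := by
    rw [edist_zero_right, Real.enorm_eq_ofReal_abs]
  have k1 := edist_le_tsum_of_edist_le_of_tendsto₀
    (fun j : ℕ => edist (upperAvg n v x (2 * (h * (1 / 2) ^ (j + 1))))
      (upperAvg n v x (h * (1 / 2) ^ (j + 1)))) (fun j => le_of_eq (by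
        rw [show 2 * (h * (1 / 2) ^ (j + 1)) = h * (1 / 2) ^ j by rw [pow_succ]; ring])) h1
  have k2 := edist_le_tsum_of_edist_le_of_tendsto₀
    (fun k : ℕ => edist (upperAvg n v x (2 * (h * 2 ^ k))) (upperAvg n v x (h * 2 ^ k)))
    (fun k => le_of_eq (by
      rw [edist_comm, show 2 * (h * 2 ^ k) = h * 2 ^ (k + 1) by rw [pow_succ]; ring])) h2
  simp only [pow_zero, mul_one] at k1 k2
  rw [e]
  exact (edist_triangle_left _ _ (upperAvg n v x h)).trans (add_le_add k1 k2)

/-! ### Integrating the step energies over the base point -/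

/-- Triples `(x, (z, y))` with `z`, `y` in the balls at heights `2 ρ(x)`, `ρ(x)` above `x`. -/
def stepSet (n : ℕ) (ρ : EuclideanSpace ℝ (Fin (n + 1)) → ℝ) :
    Set (EuclideanSpace ℝ (Fin (n + 1)) ×
      (EuclideanSpace ℝ (Fin (n + 1)) × EuclideanSpace ℝ (Fin (n + 1)))) :=
  {w | w.2.1 ∈ upperBall n w.1 (2 * ρ w.1) ∧ w.2.2 ∈ upperBall n w.1 (ρ w.1)}

theorem measurableSet_stepSet (n : ℕ) {ρ : EuclideanSpace ℝ (Fin (n + 1)) → ℝ}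
    (hρ : Measurable ρ) : MeasurableSet (stepSet n ρ) := by
  have h1 : Measurable fun w : EuclideanSpace ℝ (Fin (n + 1)) ×
      (EuclideanSpace ℝ (Fin (n + 1)) × EuclideanSpace ℝ (Fin (n + 1))) =>
      dist w.2.1 (w.1 + (2 * ρ w.1) • EuclideanSpace.single (Fin.last n) 1) := by fun_prop
  have h2 : Measurable fun w : EuclideanSpace ℝ (Fin (n + 1)) ×
      (EuclideanSpace ℝ (Fin (n + 1)) × EuclideanSpace ℝ (Fin (n + 1))) =>
      dist w.2.2 (w.1 + ρ w.1 • EuclideanSpace.single (Fin.last n) 1) := by fun_prop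
  have h3 : Measurable fun w : EuclideanSpace ℝ (Fin (n + 1)) ×
      (EuclideanSpace ℝ (Fin (n + 1)) × EuclideanSpace ℝ (Fin (n + 1))) => ρ w.1 := by fun_prop
  exact (measurableSet_lt h1 ((h3.const_mul 2).div_const 6)).inter
    (measurableSet_lt h2 (h3.div_const 6))

theorem measurable_stepEnergy (n : ℕ) (σ p : ℝ) {v : EuclideanSpace ℝ (Fin (n + 1)) → ℝ}
    (hv : Measurable v) {ρ : EuclideanSpace ℝ (Fin (n + 1)) → ℝ} (hρ : Measurable ρ) :
    Measurable fun x => stepEnergy n σ p v x (ρ x) := by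
  have hS := measurableSet_stepSet n hρ
  have hd := measurable_balancedDensity n σ p hv
  have e : (fun x => stepEnergy n σ p v x (ρ x)) = fun x => ∫⁻ q,
      (stepSet n ρ).indicator (fun w => balancedDensity n σ p v w.2) (x, q) := by
    funext x
    have hm : MeasurableSet (upperBall n x (2 * ρ x) ×ˢ upperBall n x (ρ x)) :=
      measurableSet_ball.prod measurableSet_ball
    rw [stepEnergy, ← lintegral_indicator hm]
    rfl
  rw [e]
  exact ((hd.comp measurable_snd).indicator hS).lintegral_prod_right'

/-- Tonelli: it remains to measure, for a fixed pair `q`, the base points `x` that use it. -/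
theorem lintegral_stepEnergy_eq (n : ℕ) (σ p : ℝ) {v : EuclideanSpace ℝ (Fin (n + 1)) → ℝ}
    (hv : Measurable v) {ρ : EuclideanSpace ℝ (Fin (n + 1)) → ℝ} (hρ : Measurable ρ)
    (hρ0 : ∀ x ∈ halfSpace n, 0 < ρ x) {a : EuclideanSpace ℝ (Fin (n + 1)) → ℝ≥0∞}
    (ha : Measurable a) :
    ∫⁻ x in halfSpace n, a x * stepEnergy n σ p v x (ρ x) =
      ∫⁻ q in belowPairs n 1, balancedDensity n σ p v q *
        ∫⁻ x in halfSpace n, a x * (stepSet n ρ).indicator 1 (x, q) := by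
  have hS := measurableSet_stepSet n hρ
  have hd := measurable_balancedDensity n σ p hv
  have hχ : Measurable ((stepSet n ρ).indicator 1 : _ → ℝ≥0∞) := measurable_one.indicator hS
  have e1 : ∀ x ∈ halfSpace n, a x * stepEnergy n σ p v x (ρ x) =
      ∫⁻ q in belowPairs n 1,
        balancedDensity n σ p v q * (a x * (stepSet n ρ).indicator 1 (x, q)) := by
    intro x hx
    have hsub := upperBall_prod_subset_belowPairs (n := n) hx (hρ0 x hx)
    have hm : MeasurableSet (upperBall n x (2 * ρ x) ×ˢ upperBall n x (ρ x)) :=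
      measurableSet_ball.prod measurableSet_ball
    have e : ∀ q, balancedDensity n σ p v q * (a x * (stepSet n ρ).indicator 1 (x, q)) =
        a x * (upperBall n x (2 * ρ x) ×ˢ upperBall n x (ρ x)).indicator
          (balancedDensity n σ p v) q := by
      intro q
      by_cases hq : q ∈ upperBall n x (2 * ρ x) ×ˢ upperBall n x (ρ x)
      · rw [Set.indicator_of_mem hq, Set.indicator_of_mem (show (x, q) ∈ stepSet n ρ from hq),
          Pi.one_apply, mul_one, mul_comm]
      · rw [Set.indicator_of_notMem hq,
          Set.indicator_of_notMem (show (x, q) ∉ stepSet n ρ from hq), mul_zero, mul_zero]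
    simp only [e]
    rw [lintegral_const_mul _ (hd.indicator hm), setLIntegral_indicator hm,
      Set.inter_eq_left.2 hsub, stepEnergy]
  rw [setLIntegral_congr_fun (measurableSet_halfSpace n) e1, lintegral_lintegral_swap]
  · refine lintegral_congr fun q => ?_
    rw [lintegral_const_mul]
    exact ha.mul (hχ.comp measurable_prodMk_right)
  · apply Measurable.aemeasurable
    exact (hd.comp measurable_snd).mul ((ha.comp measurable_fst).mul hχ)

/-- A pair at distance `D` is used only at scales comparable to `D` and from base points within a
multiple of `D`. The weight `D ^ (-d)` balances the volume of that region, and boundedly many scales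
occur at each `x`. -/
theorem exists_lintegral_small_steps_le (n : ℕ) (σ p : ℝ) :
    ∃ C : ℝ, 0 < C ∧ ∀ (v : EuclideanSpace ℝ (Fin (n + 1)) → ℝ), Measurable v →
      ∫⁻ x in halfSpace n, ∑' j : ℕ,
        ENNReal.ofReal ((x (Fin.last n) * (1 / 2) ^ (j + 1)) ^ (-((n + 1 : ℕ) : ℝ))) *
          stepEnergy n σ p v x (x (Fin.last n) * (1 / 2) ^ (j + 1)) ≤
      ENNReal.ofReal C * balancedEnergy n σ p v := by
  -- Serves to count scales: an admissible scale `r` satisfies `1 ≤ 2 * min (r / D) (D / r)`, so the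
  -- number of them is at most `2 * C₀`.
  obtain ⟨C₀, hC₀, hsum⟩ := exists_sum_min_rpow_le (s := 1) (t := 1) one_pos one_pos
  set ω := (volume (Metric.ball (0 : EuclideanSpace ℝ (Fin (n + 1))) 1)).toReal with hω
  have hω0 : 0 < ω := volume_ball_one_toReal_pos n
  set d : ℝ := ((n + 1 : ℕ) : ℝ) with hd
  refine ⟨(3 / 2) ^ d * 2 * C₀ * ((7 / 3) ^ (n + 1) * ω), by positivity, fun v hv => ?_⟩
  have hχ : ∀ j : ℕ, Measurable ((stepSet n fun x => x (Fin.last n) * (1 / 2) ^ (j + 1)).indicator 1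
      : _ → ℝ≥0∞) := fun j => measurable_one.indicator (measurableSet_stepSet n (by fun_prop))
  have hdens := measurable_balancedDensity n σ p hv
  have hmeas : ∀ j : ℕ, Measurable fun w : EuclideanSpace ℝ (Fin (n + 1)) ×
      (EuclideanSpace ℝ (Fin (n + 1)) × EuclideanSpace ℝ (Fin (n + 1))) =>
      ENNReal.ofReal ((w.1 (Fin.last n) * (1 / 2) ^ (j + 1)) ^ (-d)) *
        (stepSet n fun x => x (Fin.last n) * (1 / 2) ^ (j + 1)).indicator 1 w :=
    fun j => Measurable.mul (by fun_prop) (hχ j)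
  -- the total weight that the small steps give to a pair is bounded
  have key : ∀ q ∈ belowPairs n 1, ∑' j : ℕ, ∫⁻ x in halfSpace n,
      ENNReal.ofReal ((x (Fin.last n) * (1 / 2) ^ (j + 1)) ^ (-d)) *
        (stepSet n fun x => x (Fin.last n) * (1 / 2) ^ (j + 1)).indicator 1 (x, q) ≤
      ENNReal.ofReal ((3 / 2) ^ d * 2 * C₀ * ((7 / 3) ^ (n + 1) * ω)) := by
    rintro q ⟨hz, hy, hyz⟩
    rw [one_mul] at hyz
    set D := ‖q.1 - q.2‖ with hD
    have hD0 : 0 < D := by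
      rw [hD, norm_pos_iff, sub_ne_zero]
      intro h
      rw [h] at hyz
      exact lt_irrefl _ hyz
    have hmq : ∀ j : ℕ, Measurable fun x : EuclideanSpace ℝ (Fin (n + 1)) =>
        ENNReal.ofReal ((x (Fin.last n) * (1 / 2) ^ (j + 1)) ^ (-d)) *
          (stepSet n fun x => x (Fin.last n) * (1 / 2) ^ (j + 1)).indicator 1 (x, q) :=
      fun j => (hmeas j).comp measurable_prodMk_right
    rw [← lintegral_tsum fun j => (hmq j).aemeasurable]
    have hpt : ∀ x ∈ halfSpace n, ∑' j : ℕ,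
        ENNReal.ofReal ((x (Fin.last n) * (1 / 2) ^ (j + 1)) ^ (-d)) *
          (stepSet n fun x => x (Fin.last n) * (1 / 2) ^ (j + 1)).indicator 1 (x, q) ≤
        -- An admissible scale has `2 / 3 * D < r < 2 * D`, and `x` is within `7 / 6 * r` of the
        -- lower point `q.2`.
        (Metric.ball q.2 (7 / 3 * D)).indicator
          (fun _ => ENNReal.ofReal ((3 / 2) ^ d * D ^ (-d) * 2 * C₀)) x := by
      intro x hx
      have hx0 : 0 < x (Fin.last n) := hx
      set X := x (Fin.last n) / (2 * D) with hX
      have hX0 : 0 < X := by positivity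
      have hterm : ∀ j : ℕ, ENNReal.ofReal ((x (Fin.last n) * (1 / 2) ^ (j + 1)) ^ (-d)) *
          (stepSet n fun x => x (Fin.last n) * (1 / 2) ^ (j + 1)).indicator 1 (x, q) ≤
          (Metric.ball q.2 (7 / 3 * D)).indicator (fun _ => ENNReal.ofReal ((3 / 2) ^ d * D ^ (-d) *
            2 * min ((X * (1 / 2) ^ j) ^ (1 : ℝ)) ((X * (1 / 2) ^ j) ^ (-1 : ℝ)))) x := by
        intro j
        by_cases hq : (x, q) ∈ stepSet n fun x => x (Fin.last n) * (1 / 2) ^ (j + 1)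
        · rw [Set.indicator_of_mem hq, Pi.one_apply, mul_one]
          obtain ⟨hq1, hq2⟩ := hq
          simp only at hq1 hq2
          set r := x (Fin.last n) * (1 / 2) ^ (j + 1) with hr
          have hr0 : 0 < r := by positivity
          obtain ⟨h1, h2⟩ := upperBall_pair_norm hr0 hq2 hq1
          have h3 := upperBall_norm_sub hr0 hq2
          have hrX : X * (1 / 2) ^ j = r / D := by
            rw [hX, hr, pow_succ]; field_simp
          rw [Set.indicator_of_mem (by
            rw [Metric.mem_ball, dist_eq_norm]; linarith), hrX, Real.rpow_one, Real.rpow_neg_one]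
          apply ENNReal.ofReal_le_ofReal
          have h4 : r ^ (-d) ≤ (3 / 2) ^ d * D ^ (-d) := by
            have : (2 / 3) * D ≤ r := by linarith
            calc r ^ (-d) ≤ ((2 / 3) * D) ^ (-d) :=
                  Real.rpow_le_rpow_of_nonpos (by positivity) this (neg_nonpos.2 (Nat.cast_nonneg _))
              _ = (3 / 2) ^ d * D ^ (-d) := by
                  rw [Real.mul_rpow (by norm_num) hD0.le, Real.rpow_neg (by norm_num),
                    ← Real.inv_rpow (by norm_num)]
                  norm_num
          have h5 : 1 ≤ 2 * min (r / D) (r / D)⁻¹ := by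
            have : 1 / 2 ≤ min (r / D) (r / D)⁻¹ := by
              apply le_min
              · rw [le_div_iff₀ hD0]; linarith
              · rw [inv_div, le_div_iff₀ hr0]; linarith
            linarith
          rw [mul_assoc]
          calc r ^ (-d) ≤ (3 / 2) ^ d * D ^ (-d) * 1 := by rw [mul_one]; exact h4
            _ ≤ _ := by gcongr
        · rw [Set.indicator_of_notMem hq, mul_zero]
          exact zero_le
      refine (ENNReal.tsum_le_tsum hterm).trans ?_
      by_cases hb : x ∈ Metric.ball q.2 (7 / 3 * D)
      · simp only [Set.indicator_of_mem hb]
        refine ENNReal.tsum_le_of_sum_range_le fun J => ?_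
        rw [← ENNReal.ofReal_sum_of_nonneg (fun j _ => by positivity), ← Finset.mul_sum]
        apply ENNReal.ofReal_le_ofReal
        exact mul_le_mul_of_nonneg_left (hsum X hX0 J) (by positivity)
      · simp [Set.indicator_of_notMem hb]
    refine (setLIntegral_mono' (measurableSet_halfSpace n) hpt).trans ?_
    refine (setLIntegral_le_lintegral _ _).trans ?_
    rw [lintegral_indicator measurableSet_ball, setLIntegral_const,
      Measure.addHaar_ball _ _ (by positivity), finrank_euclideanSpace_fin,
      ← ENNReal.ofReal_toReal (measure_ball_lt_top (μ := volume)
        (x := (0 : EuclideanSpace ℝ (Fin (n + 1)))) (r := 1)).ne, ← hω,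
      ← ENNReal.ofReal_mul (by positivity), ← ENNReal.ofReal_mul (by positivity)]
    apply ENNReal.ofReal_le_ofReal
    refine le_of_eq ?_
    have : D ^ (-d) * D ^ (n + 1) = 1 := by
      rw [← Real.rpow_natCast, ← Real.rpow_add hD0]; simp [hd]
    rw [mul_pow]
    linear_combination ((3 / 2) ^ d * 2 * C₀ * ((7 / 3) ^ (n + 1) * ω)) * this
  have hT : ∀ j : ℕ, ∫⁻ x in halfSpace n,
      ENNReal.ofReal ((x (Fin.last n) * (1 / 2) ^ (j + 1)) ^ (-d)) *
        stepEnergy n σ p v x (x (Fin.last n) * (1 / 2) ^ (j + 1)) =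
      ∫⁻ q in belowPairs n 1, balancedDensity n σ p v q * ∫⁻ x in halfSpace n,
        ENNReal.ofReal ((x (Fin.last n) * (1 / 2) ^ (j + 1)) ^ (-d)) *
        (stepSet n fun x => x (Fin.last n) * (1 / 2) ^ (j + 1)).indicator 1 (x, q) := fun j =>
    lintegral_stepEnergy_eq n σ p hv (ρ := fun x => x (Fin.last n) * (1 / 2) ^ (j + 1))
      (a := fun x => ENNReal.ofReal ((x (Fin.last n) * (1 / 2) ^ (j + 1)) ^ (-d))) (by fun_prop)
      (fun x hx => by have : 0 < x (Fin.last n) := hx; positivity) (by fun_prop)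
  have hIm : ∀ j : ℕ, Measurable fun q => ∫⁻ x in halfSpace n,
        ENNReal.ofReal ((x (Fin.last n) * (1 / 2) ^ (j + 1)) ^ (-d)) *
        (stepSet n fun x => x (Fin.last n) * (1 / 2) ^ (j + 1)).indicator 1 (x, q) :=
    fun j => (hmeas j).lintegral_prod_left'
  have hsm : ∀ j : ℕ, Measurable fun x : EuclideanSpace ℝ (Fin (n + 1)) =>
      ENNReal.ofReal ((x (Fin.last n) * (1 / 2) ^ (j + 1)) ^ (-d)) *
        stepEnergy n σ p v x (x (Fin.last n) * (1 / 2) ^ (j + 1)) := fun j =>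
    Measurable.mul (by fun_prop) (measurable_stepEnergy n σ p hv
      (ρ := fun x => x (Fin.last n) * (1 / 2) ^ (j + 1)) (by fun_prop))
  have hqm : ∀ j : ℕ, Measurable fun q => balancedDensity n σ p v q * ∫⁻ x in halfSpace n,
        ENNReal.ofReal ((x (Fin.last n) * (1 / 2) ^ (j + 1)) ^ (-d)) *
        (stepSet n fun x => x (Fin.last n) * (1 / 2) ^ (j + 1)).indicator 1 (x, q) :=
    fun j => hdens.mul (hIm j)
  rw [lintegral_tsum fun j => (hsm j).aemeasurable, tsum_congr hT,
    ← lintegral_tsum fun j => (hqm j).aemeasurable, balancedEnergy_eq,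
    ← lintegral_const_mul _ hdens]
  refine setLIntegral_mono' (measurableSet_belowPairs n 1) fun q hq => ?_
  rw [ENNReal.tsum_mul_left, mul_comm]
  exact mul_le_mul_left (key q hq) _

/-- A pair with lower height `Y` is used only from `x` whose horizontal distance is at most a
multiple of `Y` and whose height exceeds a multiple of `Y / 2 ^ k`. Integrating `x_d ^ (-d)` there
gives a multiple of `(2 ^ k) ^ n`, a loss which the summation over `k` must absorb. -/
theorem exists_lintegral_large_step_le (n : ℕ) (hn : 1 ≤ n) (σ p : ℝ) :
    ∃ C : ℝ, 0 < C ∧ ∀ (v : EuclideanSpace ℝ (Fin (n + 1)) → ℝ), Measurable v → ∀ k : ℕ,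
      ∫⁻ x in halfSpace n, ENNReal.ofReal (x (Fin.last n) ^ (-((n + 1 : ℕ) : ℝ))) *
          stepEnergy n σ p v x (x (Fin.last n) * 2 ^ k) ≤
      ENNReal.ofReal (C * (2 ^ k) ^ n) * balancedEnergy n σ p v := by
  have hn0 : 0 < (n : ℝ) := by exact_mod_cast hn
  set ω := (volume (Metric.ball (0 : EuclideanSpace ℝ (Fin n)) 1)).toReal with hω
  have hω0 : 0 < ω :=
    ENNReal.toReal_pos (Metric.measure_ball_pos _ _ one_pos).ne' measure_ball_lt_top.ne
  set d : ℝ := ((n + 1 : ℕ) : ℝ) with hd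
  refine ⟨(7 / 5) ^ n * ω * (13 / 6) ^ n / n, by positivity, fun v hv k => ?_⟩
  have hdens := measurable_balancedDensity n σ p hv
  rw [lintegral_stepEnergy_eq n σ p hv (ρ := fun x => x (Fin.last n) * 2 ^ k)
    (a := fun x => ENNReal.ofReal (x (Fin.last n) ^ (-d))) (by fun_prop)
    (fun x hx => by have : 0 < x (Fin.last n) := hx; positivity) (by fun_prop), balancedEnergy_eq,
    ← lintegral_const_mul _ hdens]
  refine setLIntegral_mono' (measurableSet_belowPairs n 1) ?_
  rintro q ⟨hz, hy, hyz⟩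
  rw [mul_comm]
  refine mul_le_mul_left ?_ _
  set Y := q.2 (Fin.last n) with hY
  have h2k : (1 : ℝ) ≤ 2 ^ k := one_le_pow₀ (by norm_num)
  -- From `Y < x_d + 7 / 6 * x_d * 2 ^ k ≤ 13 / 6 * x_d * 2 ^ k`. The radius `7 / 5 * Y` below is `7
  -- / 6` times the bound `6 / 5 * Y` on the scale.
  set T : ℝ := Y / (2 ^ k) * (6 / 13) with hT
  have hT0 : 0 < T := by positivity
  have hpt : ∀ x ∈ halfSpace n, ENNReal.ofReal (x (Fin.last n) ^ (-d)) *
      (stepSet n fun x => x (Fin.last n) * 2 ^ k).indicator 1 (x, q) ≤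
      (Set.Ioi T).indicator (fun t => ENNReal.ofReal (t ^ (-d))) (x (Fin.last n)) *
        (Metric.ball (horizontalPart n q.2) (7 / 5 * Y)).indicator 1 (horizontalPart n x) := by
    intro x hx
    have hx0 : 0 < x (Fin.last n) := hx
    by_cases hq : (x, q) ∈ stepSet n fun x => x (Fin.last n) * 2 ^ k
    · obtain ⟨hq1, hq2⟩ := hq
      simp only at hq1 hq2
      have hr0 : 0 < x (Fin.last n) * 2 ^ k := by positivity
      have h1 := abs_lt.1 (upperBall_last hq2)
      have h2 := upperBall_norm_sub hr0 hq2
      have hxT : x (Fin.last n) ∈ Set.Ioi T := by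
        rw [Set.mem_Ioi, hT, div_mul_eq_mul_div, div_lt_iff₀ (by positivity)]
        nlinarith [h1.2]
      have hball : horizontalPart n x ∈ Metric.ball (horizontalPart n q.2) (7 / 5 * Y) := by
        rw [Metric.mem_ball, dist_eq_norm]
        have h3 := norm_sub_sq_slice n x q.2
        have h4 : ‖horizontalPart n x - horizontalPart n q.2‖ ≤ ‖x - q.2‖ := by
          apply le_of_sq_le_sq _ (norm_nonneg _)
          nlinarith [sq_nonneg (x (Fin.last n) - q.2 (Fin.last n))]
        linarith [h1.1]
      rw [Set.indicator_of_mem hxT, Set.indicator_of_mem hball, Pi.one_apply]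
      refine mul_le_mul_right ?_ _
      exact Set.indicator_le_self' (fun _ _ => zero_le) _
    · rw [Set.indicator_of_notMem hq, mul_zero]
      exact zero_le
  refine (setLIntegral_mono' (measurableSet_halfSpace n) hpt).trans ?_
  refine (setLIntegral_le_lintegral _ _).trans ?_
  have hm1 : Measurable ((Set.Ioi T).indicator fun t => ENNReal.ofReal (t ^ (-d))) :=
    Measurable.indicator (by fun_prop) measurableSet_Ioi
  have hm2 : Measurable ((Metric.ball (horizontalPart n q.2) (7 / 5 * Y)).indicator 1 :
    _ → ℝ≥0∞) := measurable_one.indicator measurableSet_ball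
  rw [lintegral_slice n (F := fun w => (Set.Ioi T).indicator (fun t => ENNReal.ofReal (t ^ (-d))) w.1 *
    (Metric.ball (horizontalPart n q.2) (7 / 5 * Y)).indicator 1 w.2)
    ((hm1.comp measurable_fst).mul (hm2.comp measurable_snd))]
  simp only
  simp_rw [lintegral_const_mul _ hm2]
  rw [lintegral_mul_const _ hm1, lintegral_indicator measurableSet_Ioi,
    lintegral_indicator_one measurableSet_ball, Measure.addHaar_ball_of_pos _ _ (by positivity),
    finrank_euclideanSpace_fin, ← ENNReal.ofReal_toReal (measure_ball_lt_top (μ := volume)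
        (x := (0 : EuclideanSpace ℝ (Fin n))) (r := 1)).ne, ← hω]
  have hd1 : -d < -1 := by
    rw [hd]; push_cast; linarith
  have hintegral : ∫⁻ t in Set.Ioi T, ENNReal.ofReal (t ^ (-d)) = ENNReal.ofReal (T ^ (-(n : ℝ)) / n) := by
    rw [← ofReal_integral_eq_lintegral_ofReal (integrableOn_Ioi_rpow_of_lt hd1 hT0),
      integral_Ioi_rpow_of_lt hd1 hT0]
    · have : -d + 1 = -(n : ℝ) := by rw [hd]; push_cast; ring
      rw [this, neg_div_neg_eq]
    · filter_upwards [ae_restrict_mem measurableSet_Ioi] with t ht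
      exact Real.rpow_nonneg (hT0.trans ht).le _
  rw [hintegral, ← ENNReal.ofReal_mul (by positivity), ← ENNReal.ofReal_mul (by positivity)]
  apply ENNReal.ofReal_le_ofReal
  refine le_of_eq ?_
  rw [Real.rpow_neg hT0.le, Real.rpow_natCast, hT]
  simp only [mul_pow, div_pow]
  field_simp

/-! ### Summing over scales -/

theorem tsum_ofReal_two_pow_rpow_neg {c : ℝ} (hc : 0 < c) :
    ∑' k : ℕ, ENNReal.ofReal (((2 : ℝ) ^ k) ^ (-c)) = ENNReal.ofReal (1 - 2 ^ (-c))⁻¹ := by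
  have h1 : (2 : ℝ) ^ (-c) < 1 := Real.rpow_lt_one_of_one_lt_of_neg (by norm_num) (by linarith)
  have h0 : (0 : ℝ) ≤ 2 ^ (-c) := by positivity
  have e : ∀ k : ℕ, ((2 : ℝ) ^ k) ^ (-c) = (2 ^ (-c)) ^ k := fun k =>
    (Real.rpow_pow_comm (by norm_num) _ _).symm
  simp only [e]
  rw [← ENNReal.ofReal_tsum_of_nonneg (fun k => by positivity)
    (summable_geometric_of_lt_one h0 h1), tsum_geometric_of_lt_one h0 h1]

/-- Interpolate every step by `e k = e k ^ (1 - θ) * e k ^ θ`, bounding the first factor by `E` and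
the second by the sum. The decay `(2 ^ k) ^ (-n)` outweighs the loss raised to the power `θ < 1`, so
a geometric series remains. -/
theorem exists_tsum_large_le {n : ℕ} (hn : 1 ≤ n) {σ p K : ℝ} (hσ : 0 < σ)
    (hσd : σ < ((n + 1 : ℕ) : ℝ)) (hp : 1 ≤ p) (hK : 0 < K) {θ : ℝ}
    (hθ : θ = (((n + 1 : ℕ) : ℝ) - σ) / ((n + 1 : ℕ) : ℝ)) :
    ∃ C : ℝ, 0 < C ∧ ∀ h : ℝ, 0 < h → ∀ (b e : ℕ → ℝ≥0∞) (E : ℝ≥0∞), (∀ k, e k ≤ E) →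
      (∀ k, b k ^ p ≤
        ENNReal.ofReal (K * (h ^ (σ - ((n + 1 : ℕ) : ℝ)) * (2 ^ k) ^ (-(n : ℝ)))) * e k) →
      ∑' k, b k ≤ ENNReal.ofReal C * (E ^ (1 - θ) * (∑' k : ℕ,
        ENNReal.ofReal ((2 ^ k) ^ (-(n + n * (1 - θ)))) *
          (ENNReal.ofReal (h ^ (-((n + 1 : ℕ) : ℝ))) * e k)) ^ θ) ^ (1 / p) := by
  set d : ℝ := ((n + 1 : ℕ) : ℝ) with hd
  have hd0 : 0 < d := by rw [hd]; positivity
  have hn0 : 0 < (n : ℝ) := by exact_mod_cast hn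
  have hp0 : 0 < p := by linarith
  have hθ0 : 0 < θ := by rw [hθ]; exact div_pos (by linarith) hd0
  have hθ1 : θ < 1 := by rw [hθ, div_lt_one hd0]; linarith
  have hdθ : d * θ = d - σ := by rw [hθ]; field_simp
  -- The surviving decay: `-n + (n + n * (1 - θ)) * θ = -n * (1 - θ) ^ 2`, divided by `p` after the
  -- root.
  set c : ℝ := n * (1 - θ) ^ 2 / p with hc
  have hc0 : 0 < c := by
    have : 0 < 1 - θ := by linarith
    positivity
  have hgeo : (0 : ℝ) < (1 - 2 ^ (-c))⁻¹ :=
    inv_pos.2 (sub_pos.2 (Real.rpow_lt_one_of_one_lt_of_neg (by norm_num) (by linarith)))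
  refine ⟨K ^ (1 / p) * (1 - 2 ^ (-c))⁻¹, by positivity, fun h hh b e E heE hb => ?_⟩
  set G := ∑' k : ℕ, ENNReal.ofReal (((2 : ℝ) ^ k) ^ (-(n + n * (1 - θ)))) *
          (ENNReal.ofReal (h ^ (-d)) * e k) with hG
  have heG : ∀ k, e k ≤ ENNReal.ofReal (((2 : ℝ) ^ k) ^ (n + n * (1 - θ)) * h ^ d) * G := by
    intro k
    have h1 := ENNReal.le_tsum (f := fun k : ℕ => ENNReal.ofReal (((2 : ℝ) ^ k) ^ (-(n + n * (1 - θ)))) *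
          (ENNReal.ofReal (h ^ (-d)) * e k)) k
    refine le_trans (le_of_eq ?_) (mul_le_mul_right h1 _)
    rw [← mul_assoc, ← mul_assoc, ← ENNReal.ofReal_mul (by positivity),
      ← ENNReal.ofReal_mul (by positivity), Real.rpow_neg (by positivity), Real.rpow_neg hh.le]
    have e1 : ((2 : ℝ) ^ k) ^ (n + n * (1 - θ)) * h ^ d *
        (((2 : ℝ) ^ k) ^ (n + n * (1 - θ)))⁻¹ * (h ^ d)⁻¹ = 1 := by
      field_simp
    rw [e1, ENNReal.ofReal_one, one_mul]
  have hbk : ∀ k, b k ≤ ENNReal.ofReal (K ^ (1 / p) * ((2 : ℝ) ^ k) ^ (-c)) *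
      (E ^ (1 - θ) * G ^ θ) ^ (1 / p) := by
    intro k
    have h1 : e k ≤ E ^ (1 - θ) *
        (ENNReal.ofReal (((2 : ℝ) ^ k) ^ (n + n * (1 - θ)) * h ^ d) * G) ^ θ := by
      calc e k = e k ^ (1 - θ) * e k ^ θ := by
            rw [← ENNReal.rpow_add_of_nonneg _ _ (by linarith) hθ0.le, sub_add_cancel,
              ENNReal.rpow_one]
        _ ≤ _ := mul_le_mul' (ENNReal.rpow_le_rpow (heE k) (by linarith))
            (ENNReal.rpow_le_rpow (heG k) hθ0.le)
    have h2 := (hb k).trans (mul_le_mul_right h1 _)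
    rw [ENNReal.mul_rpow_of_nonneg _ _ hθ0.le, ENNReal.ofReal_rpow_of_pos (by positivity),
      mul_left_comm (E ^ (1 - θ)), ← mul_assoc, ← ENNReal.ofReal_mul (by positivity)] at h2
    have e2 : K * (h ^ (σ - d) * ((2 : ℝ) ^ k) ^ (-(n : ℝ))) *
        (((2 : ℝ) ^ k) ^ (n + n * (1 - θ)) * h ^ d) ^ θ = K * ((2 : ℝ) ^ k) ^ (-(c * p)) := by
      rw [Real.mul_rpow (by positivity) (by positivity), ← Real.rpow_mul (by positivity),
        ← Real.rpow_mul hh.le, hdθ]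
      have a1 : h ^ (σ - d) * h ^ (d - σ) = 1 := by
        rw [← Real.rpow_add hh]; simp
      have a2 : ((2 : ℝ) ^ k) ^ (-(n : ℝ)) * ((2 : ℝ) ^ k) ^ ((n + n * (1 - θ)) * θ) =
          ((2 : ℝ) ^ k) ^ (-(c * p)) := by
        rw [← Real.rpow_add (by positivity)]
        congr 1
        rw [hc]; field_simp; ring
      rw [← a2]
      linear_combination (K * ((2 : ℝ) ^ k) ^ (-(n : ℝ)) *
        ((2 : ℝ) ^ k) ^ ((n + n * (1 - θ)) * θ)) * a1
    rw [e2] at h2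
    have h3 := ENNReal.rpow_le_rpow h2 (show 0 ≤ 1 / p by positivity)
    rw [← ENNReal.rpow_mul, mul_one_div_cancel hp0.ne', ENNReal.rpow_one,
      ENNReal.mul_rpow_of_nonneg _ _ (by positivity : 0 ≤ 1 / p),
      ENNReal.ofReal_rpow_of_pos (by positivity), Real.mul_rpow hK.le (by positivity),
      ← Real.rpow_mul (by positivity), show -(c * p) * (1 / p) = -c by field_simp] at h3
    exact h3
  refine (ENNReal.tsum_le_tsum hbk).trans (le_of_eq ?_)
  rw [ENNReal.tsum_mul_right]
  congr 1
  simp only [ENNReal.ofReal_mul (show 0 ≤ K ^ (1 / p) by positivity)]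
  rw [ENNReal.tsum_mul_left, tsum_ofReal_two_pow_rpow_neg hc0]

/-- Hedberg's argument: `e j` is at most both `E` and `r ^ d * G`, with `G` the weighted sum.
Against `r ^ (σ - d)` the first bound decays for large `r`, the second for small `r`, and the sum is
governed by the scale where they meet. -/
theorem exists_tsum_small_le {σ d p K : ℝ} (hσ : 0 < σ) (hσd : σ < d) (hp : 1 ≤ p) (hK : 0 < K)
    {θ : ℝ} (hθ : θ = (d - σ) / d) :
    ∃ C : ℝ, 0 < C ∧ ∀ h : ℝ, 0 < h → ∀ (b e : ℕ → ℝ≥0∞) (E : ℝ≥0∞), E ≠ ∞ → (∀ j, e j ≤ E) →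
      (∀ j, b j ^ p ≤ ENNReal.ofReal (K * (h * (1 / 2) ^ (j + 1)) ^ (σ - d)) * e j) →
      ∑' j, b j ≤ ENNReal.ofReal C * (E ^ (1 - θ) * (∑' j : ℕ,
        ENNReal.ofReal ((h * (1 / 2) ^ (j + 1)) ^ (-d)) * e j) ^ θ) ^ (1 / p) := by
  have hd0 : 0 < d := by linarith
  have hp0 : 0 < p := by linarith
  have hθ0 : 0 < θ := by rw [hθ]; exact div_pos (by linarith) hd0
  have hθ1 : θ < 1 := by rw [hθ, div_lt_one hd0]; linarith
  obtain ⟨C₀, hC₀, hsum⟩ := exists_sum_min_rpow_le (s := σ / p) (t := (d - σ) / p)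
    (by positivity) (div_pos (by linarith) hp0)
  refine ⟨K ^ (1 / p) * C₀, by positivity, fun h hh b e E hE heE hb => ?_⟩
  set G := ∑' j : ℕ, ENNReal.ofReal ((h * (1 / 2) ^ (j + 1)) ^ (-d)) * e j with hG
  have hzero : (∀ j, e j = 0) → ∑' j, b j = 0 := by
    intro h0
    rw [ENNReal.tsum_eq_zero]
    intro j
    have := hb j
    rw [h0 j, mul_zero, nonpos_iff_eq_zero, ENNReal.rpow_eq_zero_iff] at this
    rcases this with h1 | h1
    · exact h1.1
    · linarith [h1.2]
  rcases eq_or_ne E 0 with hE0 | hE0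
  · rw [hzero fun j => le_antisymm ((heE j).trans hE0.le) zero_le]
    exact zero_le
  rcases eq_or_ne G 0 with hG0 | hG0
  · rw [hzero]
    · exact zero_le
    · intro j
      have := ENNReal.tsum_eq_zero.1 hG0 j
      rcases mul_eq_zero.1 this with h1 | h1
      · rw [ENNReal.ofReal_eq_zero] at h1
        have : 0 < (h * (1 / 2) ^ (j + 1)) ^ (-d) := by positivity
        linarith
      · exact h1
  rcases eq_or_ne G ∞ with hGt | hGt
  · have h1 : E ^ (1 - θ) ≠ 0 := by
      rw [Ne, ENNReal.rpow_eq_zero_iff]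
      rintro (h2 | h2)
      · exact hE0 h2.1
      · exact hE h2.1
    rw [hGt, ENNReal.top_rpow_of_pos hθ0, ENNReal.mul_top h1,
      ENNReal.top_rpow_of_pos (by positivity), ENNReal.mul_top (by simp; positivity)]
    exact le_top
  set A := E.toReal with hA
  set B := G.toReal with hB
  have hA0 : 0 < A := ENNReal.toReal_pos hE0 hE
  have hB0 : 0 < B := ENNReal.toReal_pos hG0 hGt
  have hEA : E = ENNReal.ofReal A := (ENNReal.ofReal_toReal hE).symm
  have hGB : G = ENNReal.ofReal B := (ENNReal.ofReal_toReal hGt).symm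
  -- The scale at which the two bounds coincide, `R ^ d * B = A`; there `R ^ σ * B = A ^ (1 - θ) * B
  -- ^ θ`.
  set R := (A / B) ^ (1 / d) with hR
  have hR0 : 0 < R := by positivity
  have hRd : R ^ d = A / B := by
    rw [hR, ← Real.rpow_mul (by positivity), one_div_mul_cancel hd0.ne', Real.rpow_one]
  have hRσ : R ^ σ * B = A ^ (1 - θ) * B ^ θ := by
    have e1 : 1 - θ = σ / d := by rw [hθ]; field_simp; ring
    have e2 : B ^ θ = B / B ^ (σ / d) := by
      rw [show θ = 1 - σ / d by rw [← e1]; ring, Real.rpow_sub hB0, Real.rpow_one]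
    rw [hR, ← Real.rpow_mul (by positivity), Real.div_rpow hA0.le hB0.le, e1, e2,
      show 1 / d * σ = σ / d by ring]
    field_simp
  set X := h / (2 * R) with hX
  have hX0 : 0 < X := by positivity
  have hbj : ∀ j : ℕ, b j ≤ ENNReal.ofReal ((K * (R ^ σ * B)) ^ (1 / p) *
      min ((X * (1 / 2) ^ j) ^ (σ / p)) ((X * (1 / 2) ^ j) ^ (-((d - σ) / p)))) := by
    intro j
    set r := h * (1 / 2) ^ (j + 1) with hr
    have hr0 : 0 < r := by positivity
    have hXr : X * (1 / 2) ^ j = r / R := by rw [hX, hr, pow_succ]; field_simp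
    have h1 : e j ≤ ENNReal.ofReal (r ^ d * B) := by
      have := ENNReal.le_tsum (f := fun j : ℕ => ENNReal.ofReal ((h * (1 / 2) ^ (j + 1)) ^ (-d)) * e j) j
      rw [ENNReal.ofReal_mul (by positivity), ← hGB]
      refine le_trans (le_of_eq ?_) (mul_le_mul_right this _)
      rw [← mul_assoc, ← hr, ← ENNReal.ofReal_mul (by positivity), ← Real.rpow_add hr0,
        add_neg_cancel, Real.rpow_zero, ENNReal.ofReal_one, one_mul]
    have h2 : e j ≤ ENNReal.ofReal (min A (r ^ d * B)) := by
      rw [ENNReal.ofReal_min]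
      exact le_min ((heE j).trans hEA.le) h1
    have h3 := (hb j).trans (mul_le_mul_right h2 _)
    rw [← ENNReal.ofReal_mul (by positivity)] at h3
    have h4 : K * r ^ (σ - d) * min A (r ^ d * B) =
        K * (R ^ σ * B) * min ((r / R) ^ σ) ((r / R) ^ (-(d - σ))) := by
      have a1 : r ^ (σ - d) * A = R ^ σ * B * (r / R) ^ (-(d - σ)) := by
        rw [Real.div_rpow hr0.le hR0.le, show -(d - σ) = σ - d by ring, Real.rpow_sub hR0, hRd]
        field_simp
      have a2 : r ^ (σ - d) * (r ^ d * B) = R ^ σ * B * (r / R) ^ σ := by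
        rw [Real.div_rpow hr0.le hR0.le, Real.rpow_sub hr0]
        field_simp
      rw [mul_assoc, mul_min_of_nonneg _ _ (by positivity), a1, a2,
        ← mul_min_of_nonneg _ _ (by positivity), min_comm]
      ring
    rw [h4] at h3
    have h5 := ENNReal.rpow_le_rpow h3 (show 0 ≤ 1 / p by positivity)
    rw [← ENNReal.rpow_mul, mul_one_div_cancel hp0.ne', ENNReal.rpow_one,
      ENNReal.ofReal_rpow_of_nonneg (by positivity) (by positivity),
      Real.mul_rpow (by positivity) (by positivity)] at h5
    refine h5.trans (ENNReal.ofReal_le_ofReal ?_)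
    rw [hXr]
    gcongr
    refine le_min ?_ ?_
    · refine (Real.rpow_le_rpow (by positivity) (min_le_left _ _) (by positivity)).trans
        (le_of_eq ?_)
      rw [← Real.rpow_mul (by positivity)]; congr 1; ring
    · refine (Real.rpow_le_rpow (by positivity) (min_le_right _ _) (by positivity)).trans
        (le_of_eq ?_)
      rw [← Real.rpow_mul (by positivity)]; congr 1; ring
  refine (ENNReal.tsum_le_tsum hbj).trans ?_
  refine ENNReal.tsum_le_of_sum_range_le fun J => ?_
  rw [← ENNReal.ofReal_sum_of_nonneg (fun j _ => by positivity), ← Finset.mul_sum, hEA, hGB,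
    ENNReal.ofReal_rpow_of_pos hA0, ENNReal.ofReal_rpow_of_pos hB0,
    ← ENNReal.ofReal_mul (by positivity), ENNReal.ofReal_rpow_of_pos (by positivity),
    ← ENNReal.ofReal_mul (by positivity), hRσ, Real.mul_rpow hK.le (by positivity)]
  apply ENNReal.ofReal_le_ofReal
  calc K ^ (1 / p) * (A ^ (1 - θ) * B ^ θ) ^ (1 / p) * _
      ≤ K ^ (1 / p) * (A ^ (1 - θ) * B ^ θ) ^ (1 / p) * C₀ :=
        mul_le_mul_of_nonneg_left (hsum X hX0 J) (by positivity)
    _ = _ := by ring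

/-! ### The weighted Sobolev inequality -/

theorem exists_sobolev_balancedEnergy (n : ℕ) (hn : 1 ≤ n) {σ p q : ℝ} (hσ : 0 < σ)
    (hσd : σ < ((n + 1 : ℕ) : ℝ)) (hp : 1 ≤ p)
    (hq : q = ((n + 1 : ℕ) : ℝ) * p / (((n + 1 : ℕ) : ℝ) - σ)) :
    ∃ C : ℝ, 0 < C ∧ ∀ v : EuclideanSpace ℝ (Fin (n + 1)) → ℝ, Continuous v →
      HasCompactSupport v →
      ∫⁻ x in halfSpace n, ENNReal.ofReal (|v x| ^ q * x (Fin.last n) ^ (q / p * (σ - 1))) ≤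
        ENNReal.ofReal C * balancedEnergy n σ p v ^ (q / p) := by
  set d : ℝ := ((n + 1 : ℕ) : ℝ) with hd
  have hd0 : 0 < d := by rw [hd]; positivity
  have hn0 : 0 < (n : ℝ) := by exact_mod_cast hn
  have hp0 : 0 < p := by linarith
  have hdσ : 0 < d - σ := by linarith
  set θ := (d - σ) / d with hθ
  have hθ0 : 0 < θ := div_pos hdσ hd0
  have hθ1 : θ < 1 := by rw [hθ, div_lt_one hd0]; linarith
  have hqp : q / p = 1 / θ := by rw [hq, hθ]; field_simp
  have hq0 : 0 < q := by rw [hq]; positivity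
  obtain ⟨C₁, hC₁, hstep⟩ := exists_edist_upperAvg_rpow_le n hσ hp
  obtain ⟨CS, hCS, hS⟩ := exists_tsum_small_le hσ hσd hp
    (show 0 < C₁ * 2 ^ |1 - σ| by positivity) hθ
  obtain ⟨CL, hCL, hL⟩ := exists_tsum_large_le hn hσ hσd hp
    (show 0 < C₁ * 2 ^ |1 - σ| by positivity) hθ
  obtain ⟨DS, hDS, hIS⟩ := exists_lintegral_small_steps_le n σ p
  obtain ⟨DL, hDL, hIL⟩ := exists_lintegral_large_step_le n hn σ p
  -- The margin beyond the loss `(2 ^ k) ^ n` that makes the integrals of the large steps summable.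
  set ε : ℝ := n * (1 - θ) with hε
  have hε0 : 0 < ε := mul_pos hn0 (by linarith)
  have hgeo : (0 : ℝ) < (1 - 2 ^ (-ε))⁻¹ :=
    inv_pos.2 (sub_pos.2 (Real.rpow_lt_one_of_one_lt_of_neg (by norm_num) (by linarith)))
  refine ⟨(CS + CL) ^ q * (DS + DL * (1 - 2 ^ (-ε))⁻¹), by positivity, fun v hv hvc => ?_⟩
  set E := balancedEnergy n σ p v with hE
  rcases eq_or_ne E ∞ with hEt | hEt
  · rw [hEt, ENNReal.top_rpow_of_pos (by positivity), ENNReal.mul_top]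
    · exact le_top
    · rw [Ne, ENNReal.ofReal_eq_zero, not_le]; positivity
  set Gs : EuclideanSpace ℝ (Fin (n + 1)) → ℝ≥0∞ := fun x => ∑' j : ℕ,
    ENNReal.ofReal ((x (Fin.last n) * (1 / 2) ^ (j + 1)) ^ (-d)) *
      stepEnergy n σ p v x (x (Fin.last n) * (1 / 2) ^ (j + 1)) with hGs
  set Gl : EuclideanSpace ℝ (Fin (n + 1)) → ℝ≥0∞ := fun x => ∑' k : ℕ,
    ENNReal.ofReal ((2 ^ k) ^ (-(n + ε))) * (ENNReal.ofReal (x (Fin.last n) ^ (-d)) *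
      stepEnergy n σ p v x (x (Fin.last n) * 2 ^ k)) with hGl
  have hsmall : ∀ x ∈ halfSpace n, ENNReal.ofReal (x (Fin.last n) ^ ((σ - 1) / p)) *
      ∑' j : ℕ, edist (upperAvg n v x (2 * (x (Fin.last n) * (1 / 2) ^ (j + 1))))
        (upperAvg n v x (x (Fin.last n) * (1 / 2) ^ (j + 1))) ≤
      ENNReal.ofReal CS * (E ^ (1 - θ) * Gs x ^ θ) ^ (1 / p) := by
    intro x hx
    have hx0 : 0 < x (Fin.last n) := hx
    set h := x (Fin.last n) with hh
    rw [← ENNReal.tsum_mul_left]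
    refine hS h hx0 _ (fun j => stepEnergy n σ p v x (h * (1 / 2) ^ (j + 1))) E hEt
      (fun j => stepEnergy_le n σ p v hx0 (by positivity)) fun j => ?_
    set r := h * (1 / 2) ^ (j + 1) with hr
    have hr0 : 0 < r := by positivity
    have hrh : r ≤ h := mul_le_of_le_one_right hx0.le (pow_le_one₀ (by norm_num) (by norm_num))
    -- On small steps `h + r` is comparable to `h`, so the weight `h ^ (σ - 1)` cancels exactly.
    have hc := rpow_le_of_comparable (K := 2) (r := h + r) (R := h) (c := 1 - σ) (by norm_num) hx0
      (by positivity) (by linarith) (by linarith)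
    rw [ENNReal.mul_rpow_of_nonneg _ _ hp0.le, ENNReal.ofReal_rpow_of_pos (by positivity),
      ← Real.rpow_mul hx0.le, div_mul_cancel₀ _ hp0.ne']
    refine (mul_le_mul_right (hstep v hv hvc x r hx0 hr0) _).trans ?_
    rw [← mul_assoc, ← ENNReal.ofReal_mul (by positivity)]
    refine mul_le_mul_left (ENNReal.ofReal_le_ofReal ?_) _
    have a1 : h ^ (σ - 1) * h ^ (1 - σ) = 1 := by rw [← Real.rpow_add hx0]; simp
    calc h ^ (σ - 1) * (C₁ * (r ^ (σ - d) * (h + r) ^ (1 - σ)))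
        ≤ h ^ (σ - 1) * (C₁ * (r ^ (σ - d) * (2 ^ |1 - σ| * h ^ (1 - σ)))) := by gcongr
      _ = C₁ * 2 ^ |1 - σ| * r ^ (σ - d) := by
          linear_combination (C₁ * 2 ^ |1 - σ| * r ^ (σ - d)) * a1
  have hlarge : ∀ x ∈ halfSpace n, ENNReal.ofReal (x (Fin.last n) ^ ((σ - 1) / p)) *
      ∑' k : ℕ, edist (upperAvg n v x (2 * (x (Fin.last n) * 2 ^ k)))
        (upperAvg n v x (x (Fin.last n) * 2 ^ k)) ≤
      ENNReal.ofReal CL * (E ^ (1 - θ) * Gl x ^ θ) ^ (1 / p) := by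
    intro x hx
    have hx0 : 0 < x (Fin.last n) := hx
    set h := x (Fin.last n) with hh
    rw [← ENNReal.tsum_mul_left]
    refine hL h hx0 _ (fun k => stepEnergy n σ p v x (h * 2 ^ k)) E
      (fun k => stepEnergy_le n σ p v hx0 (by positivity)) fun k => ?_
    set r := h * 2 ^ k with hr
    have hr0 : 0 < r := by positivity
    have hrh : h ≤ r := le_mul_of_one_le_right hx0.le (one_le_pow₀ (by norm_num))
    -- On large steps `h + r` is comparable to `r`, and the product of powers is `h ^ (σ - d) * (2 ^
    -- k) ^ (-n)`.
    have hc := rpow_le_of_comparable (K := 2) (r := h + r) (R := r) (c := 1 - σ) (by norm_num) hr0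
      (by positivity) (by linarith) (by linarith)
    rw [ENNReal.mul_rpow_of_nonneg _ _ hp0.le, ENNReal.ofReal_rpow_of_pos (by positivity),
      ← Real.rpow_mul hx0.le, div_mul_cancel₀ _ hp0.ne']
    refine (mul_le_mul_right (hstep v hv hvc x r hx0 hr0) _).trans ?_
    rw [← mul_assoc, ← ENNReal.ofReal_mul (by positivity)]
    refine mul_le_mul_left (ENNReal.ofReal_le_ofReal ?_) _
    have a1 : h ^ (σ - 1) * (r ^ (σ - d) * r ^ (1 - σ)) =
        h ^ (σ - d) * ((2 : ℝ) ^ k) ^ (-(n : ℝ)) := by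
      have hdn : σ - d + (1 - σ) = -(n : ℝ) := by rw [hd]; push_cast; ring
      rw [← Real.rpow_add hr0, hdn, hr, Real.mul_rpow hx0.le (by positivity), ← mul_assoc,
        ← Real.rpow_add hx0]
      congr 2
      rw [hd]; push_cast; ring
    calc h ^ (σ - 1) * (C₁ * (r ^ (σ - d) * (h + r) ^ (1 - σ)))
        ≤ h ^ (σ - 1) * (C₁ * (r ^ (σ - d) * (2 ^ |1 - σ| * r ^ (1 - σ)))) := by gcongr
      _ = C₁ * 2 ^ |1 - σ| * (h ^ (σ - 1) * (r ^ (σ - d) * r ^ (1 - σ))) := by ring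
      _ = _ := by rw [a1]
  have hpt : ∀ x ∈ halfSpace n,
      ENNReal.ofReal (|v x| ^ q * x (Fin.last n) ^ (q / p * (σ - 1))) ≤
        ENNReal.ofReal ((CS + CL) ^ q) * E ^ (q / p - 1) * (Gs x + Gl x) := by
    intro x hx
    have hx0 : 0 < x (Fin.last n) := hx
    have e1 : ENNReal.ofReal (|v x| ^ q * x (Fin.last n) ^ (q / p * (σ - 1))) =
        (ENNReal.ofReal (x (Fin.last n) ^ ((σ - 1) / p)) * ENNReal.ofReal |v x|) ^ q := by
      rw [← ENNReal.ofReal_mul (by positivity), ENNReal.ofReal_rpow_of_nonneg (by positivity) hq0.le,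
        Real.mul_rpow (by positivity) (abs_nonneg _), ← Real.rpow_mul hx0.le, mul_comm]
      congr 3; ring
    rw [e1]
    have h1 : ENNReal.ofReal (x (Fin.last n) ^ ((σ - 1) / p)) * ENNReal.ofReal |v x| ≤
        ENNReal.ofReal (CS + CL) * (E ^ (1 - θ) * (Gs x + Gl x) ^ θ) ^ (1 / p) := by
      refine (mul_le_mul_right (enorm_le_tsum_edist_upperAvg n hv hvc x hx0) _).trans ?_
      rw [mul_add, ENNReal.ofReal_add hCS.le hCL.le, add_mul]
      refine add_le_add ((hsmall x hx).trans ?_) ((hlarge x hx).trans ?_)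
      · gcongr
        exact le_self_add
      · gcongr
        exact le_add_self
    -- Since `q / p = 1 / θ`, the `q`-th power makes the bound linear in `Gs x + Gl x`, which can be
    -- integrated.
    refine (ENNReal.rpow_le_rpow h1 hq0.le).trans (le_of_eq ?_)
    rw [ENNReal.mul_rpow_of_nonneg _ _ hq0.le, ENNReal.ofReal_rpow_of_pos (by positivity),
      ← ENNReal.rpow_mul, ENNReal.mul_rpow_of_nonneg _ _ (by positivity), ← ENNReal.rpow_mul,
      ← ENNReal.rpow_mul, mul_assoc, show 1 / p * q = 1 / θ by rw [← hqp]; ring,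
      mul_one_div_cancel hθ0.ne', ENNReal.rpow_one, hqp]
    congr 3
    field_simp
  have hmS : ∀ j : ℕ, Measurable fun x : EuclideanSpace ℝ (Fin (n + 1)) =>
      ENNReal.ofReal ((x (Fin.last n) * (1 / 2) ^ (j + 1)) ^ (-d)) *
        stepEnergy n σ p v x (x (Fin.last n) * (1 / 2) ^ (j + 1)) := fun j =>
    Measurable.mul (by fun_prop) (measurable_stepEnergy n σ p hv.measurable
      (ρ := fun x => x (Fin.last n) * (1 / 2) ^ (j + 1)) (by fun_prop))
  have hmL : ∀ k : ℕ, Measurable fun x : EuclideanSpace ℝ (Fin (n + 1)) =>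
      ENNReal.ofReal (x (Fin.last n) ^ (-d)) *
        stepEnergy n σ p v x (x (Fin.last n) * 2 ^ k) := fun k =>
    Measurable.mul (by fun_prop) (measurable_stepEnergy n σ p hv.measurable
      (ρ := fun x => x (Fin.last n) * 2 ^ k) (by fun_prop))
  have hGsm : Measurable Gs := Measurable.tsum hmS
  have hGlm : Measurable Gl := Measurable.tsum fun k => (hmL k).const_mul _
  have hGsi : ∫⁻ x in halfSpace n, Gs x ≤ ENNReal.ofReal DS * E := hIS v hv.measurable
  have hGli : ∫⁻ x in halfSpace n, Gl x ≤ ENNReal.ofReal (DL * (1 - 2 ^ (-ε))⁻¹) * E := by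
    simp only [hGl]
    rw [lintegral_tsum fun k => ((hmL k).const_mul _).aemeasurable]
    have hk : ∀ k : ℕ, ∫⁻ x in halfSpace n, ENNReal.ofReal ((2 ^ k) ^ (-(n + ε))) *
        (ENNReal.ofReal (x (Fin.last n) ^ (-d)) * stepEnergy n σ p v x (x (Fin.last n) * 2 ^ k)) ≤
        ENNReal.ofReal DL * E * ENNReal.ofReal (((2 : ℝ) ^ k) ^ (-ε)) := by
      intro k
      rw [lintegral_const_mul _ (hmL k)]
      refine (mul_le_mul_right (hIL v hv.measurable k) _).trans (le_of_eq ?_)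
      rw [← mul_assoc, ← ENNReal.ofReal_mul (by positivity), mul_right_comm,
        ← ENNReal.ofReal_mul hDL.le]
      congr 2
      rw [neg_add, Real.rpow_add (by positivity), Real.rpow_neg (by positivity), Real.rpow_natCast]
      field_simp
    refine (ENNReal.tsum_le_tsum hk).trans (le_of_eq ?_)
    rw [ENNReal.tsum_mul_left, tsum_ofReal_two_pow_rpow_neg hε0, mul_right_comm,
      ← ENNReal.ofReal_mul hDL.le]
  refine (setLIntegral_mono' (measurableSet_halfSpace n) hpt).trans ?_
  rw [lintegral_const_mul _ (show Measurable fun x => Gs x + Gl x from hGsm.add hGlm),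
    lintegral_add_left hGsm]
  refine (mul_le_mul_right (add_le_add hGsi hGli) _).trans (le_of_eq ?_)
  have hqp1 : 0 ≤ q / p - 1 := by
    rw [hqp, sub_nonneg, le_div_iff₀ hθ0]; linarith
  have e2 : E ^ (q / p) = E ^ (q / p - 1) * E := by
    conv_rhs => rw [← ENNReal.rpow_one E]
    rw [← ENNReal.rpow_mul, one_mul, ← ENNReal.rpow_add_of_nonneg _ _ hqp1 zero_le_one,
      sub_add_cancel]
  rw [e2, ENNReal.ofReal_mul (show 0 ≤ (CS + CL) ^ q by positivity),
    ENNReal.ofReal_add hDS.le (by positivity)]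
  ring

/-! ### Admissibility of the transformed function and conclusion -/

theorem continuous_mul_of_tsupport_subset (n : ℕ) {f : EuclideanSpace ℝ (Fin (n + 1)) → ℝ}
    (hf : Continuous f) (hsupp : tsupport f ⊆ halfSpace n) (c : ℝ) :
    Continuous fun x => f x * x (Fin.last n) ^ c := by
  refine continuous_of_tsupport fun x hx => ?_
  have hx0 : 0 < x (Fin.last n) := hsupp (tsupport_mul_subset_left hx)
  refine hf.continuousAt.mul (ContinuousAt.rpow_const ?_ (Or.inl hx0.ne'))
  fun_prop

theorem hardyTerm_lt_top (n : ℕ) {s p α β : ℝ} (hp : 0 < p)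
    {u : EuclideanSpace ℝ (Fin (n + 1)) → ℝ} (hu : u ∈ CcHalfSpace n) :
    hardyTerm n s p α β u < ∞ := by
  obtain ⟨hc, hcs, hsupp⟩ := hu
  have hss : Function.support (fun x => |u x| ^ p) ⊆ Function.support u := by
    intro x hx hux
    apply hx
    simp [hux, Real.zero_rpow hp.ne']
  have hcp : Continuous fun x => |u x| ^ p := hc.abs.rpow_const fun x => Or.inr hp.le
  have hcont := continuous_mul_of_tsupport_subset n hcp ((closure_mono hss).trans hsupp)
    (-(s * p - α - β))
  have hintegral := hcont.integrable_of_hasCompactSupport (μ := volume) ((hcs.mono hss).mul_right)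
  refine lt_of_le_of_lt ?_ hintegral.lintegral_lt_top
  refine le_trans (le_of_eq ?_) (setLIntegral_le_lintegral (halfSpace n) _)
  refine setLIntegral_congr_fun (measurableSet_halfSpace n) fun x hx => ?_
  have hx0 : 0 < x (Fin.last n) := hx
  rw [Real.rpow_neg hx0.le, div_eq_mul_inv]

/-- The exponents match because `γ * q + q / p * (σ - 1) = q / p * (α + β)`. -/
theorem sobolevIntegral_eq (n : ℕ) {σ p q α β γ : ℝ} (hp : 0 < p)
    (hγ : γ = (1 + α + β - σ) / p) (u : EuclideanSpace ℝ (Fin (n + 1)) → ℝ) :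
    sobolevIntegral n p q α β u = ∫⁻ x in halfSpace n, ENNReal.ofReal
      (|u x * x (Fin.last n) ^ γ| ^ q * x (Fin.last n) ^ (q / p * (σ - 1))) := by
  refine setLIntegral_congr_fun (measurableSet_halfSpace n) fun x hx => ?_
  have hx0 : 0 < x (Fin.last n) := hx
  simp only
  rw [abs_mul, abs_of_pos (Real.rpow_pos_of_pos hx0 γ),
    Real.mul_rpow (abs_nonneg _) (by positivity), ← Real.rpow_mul hx0.le, mul_assoc,
    ← Real.rpow_add hx0]
  congr 3
  rw [hγ]; field_simp; ring

/-- The dimension is `d = n + 1 ≥ 2`. Since `𝒟` times the Hardy term is finite, the inequality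
between sums in `[0, ∞]` is the inequality `energy - 𝒟 * hardyTerm ≥ C * (…) ^ (p / q)`, also
when the energy is infinite. -/
theorem theorem1p3 (n : ℕ) (hn : 1 ≤ n) (s p α β q : ℝ)
    (hs0 : 0 < s) (hs1 : s < 1) (hp : 2 ≤ p) (hsp : s * p < ((n + 1 : ℕ) : ℝ))
    (hα : α ∈ Set.Ioo (-1) (s * p)) (hβ : β ∈ Set.Ioo (-1) (s * p))
    (hαβ : α + β ∈ Set.Ioo (-1) (s * p)) (hne : 1 + α + β ≠ s * p)
    (hq : q = ((n + 1 : ℕ) : ℝ) * p / (((n + 1 : ℕ) : ℝ) - s * p)) :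
    ∃ C : ℝ≥0, 0 < C ∧ ∀ u ∈ CcHalfSpace n,
      hardyConst (n + 1) s p α β * hardyTerm n s p α β u < ∞ ∧
      hardyConst (n + 1) s p α β * hardyTerm n s p α β u +
          (C : ℝ≥0∞) * sobolevIntegral n p q α β u ^ (p / q) ≤
        weightedEnergy n s p α β u := by
  have hp0 : 0 < p := by linarith
  have hσ : 0 < s * p := mul_pos hs0 hp0
  have hσp : s * p < p := by nlinarith
  have hdσ : 0 < ((n + 1 : ℕ) : ℝ) - s * p := by linarith
  have hq0 : 0 < q := by rw [hq]; positivity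
  obtain ⟨C₀, hC₀, hsob⟩ := exists_sobolev_balancedEnergy n hn hσ hsp (by linarith) hq
  -- The gain of `groundState_pointwise` times the factor `2` from AM-GM.
  set c : ℝ := (2 ^ (1 - p)) ^ 2 * 2 with hc
  have hc0 : 0 < c := by positivity
  have hC : 0 < c / C₀ ^ (p / q) := by positivity
  refine ⟨(c / C₀ ^ (p / q)).toNNReal, Real.toNNReal_pos.2 hC, fun u hu => ?_⟩
  have hfin : hardyTerm n s p α β u < ∞ := hardyTerm_lt_top n hp0 hu
  set γ := (1 + α + β - s * p) / p with hγ
  have hD : hardyConst (n + 1) s p α β < ∞ :=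
    ENNReal.mul_lt_top ENNReal.ofReal_lt_top (hardyIntegral_lt_top hp0 hσp hα hβ hγ)
  refine ⟨ENNReal.mul_lt_top hD hfin, ?_⟩
  obtain ⟨hcu, hcs, hsupp⟩ := hu
  refine le_trans (add_le_add_right ?_ _)
    (hardy_add_balancedEnergy_le n hp hσ hα hβ hγ hcu.measurable hfin)
  have h1 := hsob (fun x => u x * x (Fin.last n) ^ γ)
    (continuous_mul_of_tsupport_subset n hcu hsupp γ) hcs.mul_right
  rw [← sobolevIntegral_eq n hp0 hγ] at h1
  have h2 := ENNReal.rpow_le_rpow h1 (show 0 ≤ p / q by positivity)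
  rw [ENNReal.mul_rpow_of_nonneg _ _ (by positivity), ← ENNReal.rpow_mul,
    show q / p * (p / q) = 1 by field_simp, ENNReal.rpow_one,
    ENNReal.ofReal_rpow_of_pos hC₀] at h2
  refine (mul_le_mul_right h2 _).trans (le_of_eq ?_)
  have e : ((c / C₀ ^ (p / q)).toNNReal : ℝ≥0∞) = ENNReal.ofReal (c / C₀ ^ (p / q)) := rfl
  have e2 : c / C₀ ^ (p / q) * C₀ ^ (p / q) = c := by field_simp
  rw [e, ← mul_assoc, ← ENNReal.ofReal_mul hC.le, e2, hc, ENNReal.ofReal_mul (by positivity),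
    ENNReal.ofReal_ofNat, mul_assoc]
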